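/- Fix integers $p,a,b,L$ with $1\le a,b\le p$, $L\ge 0$ and $L+a+b$ even, and let $e,f\in\{0,1\}$. \textbf{Paths.} Let $\mathcal{R}^{e,f;p}_{a,b}(L)$ be the set of integer sequences $h=(h_{-1},h_0,\dots,h_L,h_{L+1})$ with $|h_i-h_{i-1}|=1$ for $0\le i\le L+1$, $1\le h_i\le p$ for $0\le i\le L$, $h_0=a$, $h_L=b$, $h_{-1}=a+1-2e$, $h_{L+1}=b+1-2f$, which have no valley at an even height, i.e. there is no $i$ with $0\le i\le L$, $h_i$ even and $h_{i-1}=h_{i+1}=h_i+1$. Put $$w^\circ(h)=\tfrac14\sum_{i=1}^{L} i\,|h_{i+1}-h_{i-1}|,\qquad R^{e,f;p}_{a,b}(L)=\sum_{h\in\mathcal{R}^{e,f;p}_{a,b}(L)}q^{w^\circ(h)} .$$ \textbf{Notation.} Let $|x|_+=\max(x,0)$ and $(x)_n=\prod_{i=1}^n(1-x^i)$. The modified Gaussian binomial in base $x$ is $\left[{n+m\atop n}\right]'_x=\frac{(x)_{n+m}}{(x)_n(x)_m}$ if $n,m\ge0$; it is $1$ if $n=0$ and $m=-1$; and it is $0$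 otherwise. For $1\le i\le j$ let $Q^{(c,j)}_i\in\{0,1\}$ be the residue of $|c-1-i|_+$ modulo $2$, and let $R^{(c,j)}_i\in\{0,1\}$ be the residue of $|i+c-j-1|_+ +c+1$ modulo $2$. Let $C$ be the $(p-2)\times(p-2)$ Cartan matrix of type $A_{p-2}$ ($C_{i,i}=2$, $C_{i,i\pm1}=-1$, all other entries $0$). \textbf{Theorem.} In each of the following four cases, with the stated restrictions on $a,b$ and the stated values of $\ell$, $\Delta_i$ $(0\le i<p)$ and $T^{L},T^{R}\in\{0,1\}^{p-1}$: (a) $(e,f)=(1,1)$, $a\ne1$, $b\ne1$: $\ell=a-1$, $\Delta_i=|a-1-i|_++|b-1-i|_+$, $T^L=Q^{(a,p-1)}$, $T^R=Q^{(b,p-1)}$; (b) $(e,f)=(0,1)$, $a\ne p$, $b\ne1$: $\ell=p-a$, $\Delta_i=|p-a-i|_++|b-1-i|_++p-1-i$, $T^L=R^{(a,p-1)}$, $T^R=Q^{(b,p-1)}$; (c) $(e,f)=(0,0)$, $a\ne p$, $b\ne p$: $\ell=p-a$, $\Delta_i=|p-a-i|_++|p-b-i|_+$, $T^L=R^{(a,p-1)}$,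 $T^R=R^{(b,p-1)}$; (d) $(e,f)=(1,0)$, $a\ne1$, $b\ne p$: $\ell=a-1$, $\Delta_i=|a-1-i|_++|p-b-i|_++p-1-i$, $T^L=Q^{(a,p-1)}$, $T^R=R^{(b,p-1)}$; one has $$R^{e,f;p}_{a,b}(L)=\sum_{n}\;q^{\frac14 mCm^T-\frac12 m_\ell+n\cdot T^R}\prod_{i=1}^{p-2}\left[{n_i+\hat m_i\atop n_i}\right]'_{q^2},$$ where for $n=(n_1,\dots,n_{p-1})\in\mathbb{Z}_{\ge0}^{p-1}$ $$m_i=2\sum_{i<k<p}(k-i)n_k-\Delta_i\ (0\le i<p),\qquad \hat m_i=\tfrac12(m_i-T^L_i-T^R_i)\ (1\le i<p),\qquad m=(m_1,\dots,m_{p-2}),$$ and the sum runs over all $n\in\mathbb{Z}_{\ge0}^{p-1}$ with $m_0=L$, of which there are finitely many. Moreover, for every $n\in\mathbb{Z}_{\ge0}^{p-1}$, $m_{p-1}=0$, and for $1\le i<p-1$ the number $\hat m_i$ is an integer equal to $\frac12m_i$, $\frac12(m_i-1)$ or $\frac12m_i-1$. -/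

import Mathlib

open scoped BigOperators

noncomputable section

/-! ## The ring of generating functions -/

/-- The field of Hahn series in `q` with rational exponents and rational coefficients.
All generating functions below are finite sums of monomials `q ^ r`; the field only serves to
have fractional powers of `q` and the quotients in the Gaussian polynomials at hand. -/
abbrev QField : Type := HahnSeries ℚ ℚ

/-- The monomial `q ^ r`. -/
def qPow (r : ℚ) : QField := HahnSeries.single r 1

/-- `(x)_n = ∏_{i=1}^n (1 - x ^ i)`. -/
def qFactorial (x : QField) (n : ℕ) : QField := ∏ i ∈ Finset.Icc 1 n, (1 - x ^ i)

/-- The modified Gaussian binomial `[n + m; n]'` in the base `x`: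
the usual one if `n, m ≥ 0`, equal to `1` if `n = 0` and `m = -1`, and `0` otherwise. -/
def qBinomMod (x : QField) (n m : ℤ) : QField :=
  if 0 ≤ n ∧ 0 ≤ m then
    qFactorial x (n + m).toNat / (qFactorial x n.toNat * qFactorial x m.toNat)
  else if n = 0 ∧ m = -1 then 1
  else 0

/-! ## ABF paths

A path `(h_{-1}, h_0, …, h_L, h_{L+1})` is stored as `h : Fin (L + 3) → ℤ`, the entry with
number `j` being `h_{j-1}`. For `i = 0, …, L` the three heights `h_{i-1}`, `h_i`, `h_{i+1}` are
`htPrev h i`, `ht h i` and `htNext h i`. -/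

/-- The height `h_{i-1}`, for `0 ≤ i ≤ L`. -/
def htPrev {L : ℕ} (h : Fin (L + 3) → ℤ) (i : Fin (L + 1)) : ℤ := h i.castSucc.castSucc

/-- The height `h_i`, for `0 ≤ i ≤ L`. -/
def ht {L : ℕ} (h : Fin (L + 3) → ℤ) (i : Fin (L + 1)) : ℤ := h i.castSucc.succ

/-- The height `h_{i+1}`, for `0 ≤ i ≤ L`. -/
def htNext {L : ℕ} (h : Fin (L + 3) → ℤ) (i : Fin (L + 1)) : ℤ := h i.succ.succ

/-- Consecutive heights differ by one: `|h_i - h_{i-1}| = 1` for `0 ≤ i ≤ L + 1`. -/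
def IsABFPath {L : ℕ} (h : Fin (L + 3) → ℤ) : Prop :=
  ∀ i : Fin (L + 2), |h i.succ - h i.castSucc| = 1

/-- The set of `(1, p)`-restricted ABF paths of length `L` with `h_0 = a`, `h_L = b`,
`h_{-1} = a + 1 - 2 e` and `h_{L+1} = b + 1 - 2 f`. -/
def abfPaths (p a b e f L : ℕ) : Set (Fin (L + 3) → ℤ) :=
  {h | IsABFPath h ∧
    (∀ i : Fin (L + 1), 1 ≤ ht h i ∧ ht h i ≤ p) ∧
    ht h 0 = a ∧ ht h (Fin.last L) = b ∧
    htPrev h 0 = (a : ℤ) + 1 - 2 * e ∧ htNext h (Fin.last L) = (b : ℤ) + 1 - 2 * f}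

/-- The vertex `(i, h_i)` is a valley: it is entered by a SE edge and left by a NE edge. -/
def IsValley {L : ℕ} (h : Fin (L + 3) → ℤ) (i : Fin (L + 1)) : Prop :=
  ht h i = htPrev h i - 1 ∧ htNext h i = ht h i + 1

/-- No valley at an even height; the vertices `(0, h_0)` and `(L, h_L)` count as well. -/
def IsValleyRestricted {L : ℕ} (h : Fin (L + 3) → ℤ) : Prop :=
  ∀ i : Fin (L + 1), IsValley h i → ¬ Even (ht h i)

/-- The weight `(1/4) ∑_{i=1}^L i |h_{i+1} - h_{i-1}|` (the term `i = 0` vanishes). -/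
def pathWeight {L : ℕ} (h : Fin (L + 3) → ℤ) : ℚ :=
  1 / 4 * ∑ i : Fin (L + 1), (i : ℚ) * |((htNext h i - htPrev h i : ℤ) : ℚ)|

/-- The set of valley-restricted paths. -/
def restrictedPaths (p a b e f L : ℕ) : Set (Fin (L + 3) → ℤ) :=
  {h | h ∈ abfPaths p a b e f L ∧ IsValleyRestricted h}

/-- The generating function of the valley-restricted paths of length `L`; the index set is finite
by `restrictedPaths_finite`. -/
def restrictedGF (p a b e f L : ℕ) : QField :=
  ∑ᶠ h ∈ restrictedPaths p a b e f L, qPow (pathWeight h)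

theorem abfPaths_finite (p a b e f L : ℕ) : (abfPaths p a b e f L).Finite := by
  refine (Set.Finite.pi (t := fun _ : Fin (L + 3) => Set.Icc (0 : ℤ) (p + 1))
    (fun _ => Set.finite_Icc _ _)).subset ?_
  rintro h ⟨hstep, hres, -⟩ j -
  have hj : (∃ i : Fin (L + 2), j = i.succ) ∨ j = 0 := by
    rcases Fin.eq_zero_or_eq_succ j with h0 | h1
    · exact Or.inr h0
    · exact Or.inl h1
  rcases hj with ⟨i, rfl⟩ | rfl
  · rcases Fin.eq_castSucc_or_eq_last i with ⟨k, rfl⟩ | rfl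
    · have := hres k
      simp only [ht] at this
      simp only [Set.mem_Icc]
      omega
    · have h1 := hres (Fin.last L)
      have h2 := abs_eq (zero_le_one' ℤ) |>.1 (hstep (Fin.last (L + 1)))
      have h3 : (Fin.last (L + 1)).castSucc = (Fin.last L).castSucc.succ := rfl
      rw [h3] at h2
      simp only [ht] at h1
      simp only [Set.mem_Icc]
      omega
  · have h1 := hres 0
    have h2 := abs_eq (zero_le_one' ℤ) |>.1 (hstep 0)
    have h3 : (0 : Fin (L + 2)).succ = (0 : Fin (L + 1)).castSucc.succ := rfl
    have h4 : (0 : Fin (L + 2)).castSucc = (0 : Fin (L + 3)) := rfl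
    rw [h3, h4] at h2
    simp only [ht] at h1
    simp only [Set.mem_Icc]
    omega

theorem restrictedPaths_finite (p a b e f L : ℕ) : (restrictedPaths p a b e f L).Finite :=
  (abfPaths_finite p a b e f L).subset fun _ hh => hh.1

/-! ## The fermionic side -/

/-- `|x|₊ = x` if `x > 0` and `0` otherwise. -/
def pPart (x : ℤ) : ℤ := max x 0

/-- The parity vector `Q^{(c,j)}`, for `1 ≤ i ≤ j`: `Q_i = |c - 1 - i|₊ mod 2`
(`j` is only the length of the vector). -/
def parityQ (c _j i : ℕ) : ℤ := pPart ((c : ℤ) - 1 - i) % 2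

/-- The parity vector `R^{(c,j)}`, for `1 ≤ i ≤ j`: `R_i = (|i + c - j - 1|₊ + c + 1) mod 2`. -/
def parityR (c j i : ℕ) : ℤ := (pPart ((i : ℤ) + c - j - 1) + c + 1) % 2

/-- The component `n_k` of `n = (n_1, …, n_{p-1})`. -/
def comp {p : ℕ} (n : Fin (p - 1) → ℕ) (k : ℕ) : ℕ :=
  if hk : 1 ≤ k ∧ k ≤ p - 1 then n ⟨k - 1, by omega⟩ else 0

/-- `m_i = 2 ∑_{i < k < p} (k - i) n_k - Δ_i`. -/
def mVal {p : ℕ} (Δ : ℕ → ℤ) (n : Fin (p - 1) → ℕ) (i : ℕ) : ℤ :=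
  2 * ∑ k ∈ Finset.Ioo i p, ((k : ℤ) - i) * comp n k - Δ i

/-- `m̂_i = (m_i - T^L_i - T^R_i) / 2`. This is an exact division in the cases that matter,
which `HasFermionicForm` states as a part of the claim. -/
def mHat {p : ℕ} (Δ TL TR : ℕ → ℤ) (n : Fin (p - 1) → ℕ) (i : ℕ) : ℤ :=
  (mVal Δ n i - TL i - TR i) / 2

/-- The quadratic form `m C mᵀ` for `m = (m_1, …, m_{p-2})`, where `C` is the Cartan matrix of
type `A_{p-2}`. -/
def quadForm {p : ℕ} (Δ : ℕ → ℤ) (n : Fin (p - 1) → ℕ) : ℤ :=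
  let m : Fin (p - 2) → ℤ := fun i => mVal Δ n (i + 1)
  m ⬝ᵥ (CartanMatrix.A (p - 2)).mulVec m

/-- The summand
`q^{(1/4) m C mᵀ - (1/2) m_ℓ + n · T^R} ∏_{i=1}^{p-2} [n_i + m̂_i; n_i]'_{q²}`. -/
def fermionicTerm (p ℓ : ℕ) (Δ TL TR : ℕ → ℤ) (n : Fin (p - 1) → ℕ) : QField :=
  qPow (1 / 4 * (quadForm Δ n : ℚ) - 1 / 2 * (mVal Δ n ℓ : ℚ)
      + ((∑ i ∈ Finset.Icc 1 (p - 1), (comp n i : ℤ) * TR i : ℤ) : ℚ)) *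
    ∏ i ∈ Finset.Icc 1 (p - 2), qBinomMod (qPow 2) (comp n i) (mHat Δ TL TR n i)

/-- The index set of the sum: the `n ∈ ℤ_{≥0}^{p-1}` with `m_0 = L`. -/
def fermionicIndex (p L : ℕ) (Δ : ℕ → ℤ) : Set (Fin (p - 1) → ℕ) := {n | mVal Δ n 0 = L}

/-- The generating function `G` equals the (finite) fermionic sum with parameters
`ℓ, Δ, T^L, T^R`; moreover, for every `n`, `m_{p-1} = 0`, and for `1 ≤ i < p - 1` the
number `m̂_i` is an integer equal to `m_i / 2`, `(m_i - 1) / 2` or `m_i / 2 - 1`. -/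
def HasFermionicForm (G : QField) (p L ℓ : ℕ) (Δ TL TR : ℕ → ℤ) : Prop :=
  (fermionicIndex p L Δ).Finite ∧
  (∀ n : Fin (p - 1) → ℕ, mVal Δ n (p - 1) = 0 ∧
    ∀ i, 1 ≤ i → i < p - 1 →
      2 * mHat Δ TL TR n i = mVal Δ n i - TL i - TR i ∧
      (2 * mHat Δ TL TR n i = mVal Δ n i ∨ 2 * mHat Δ TL TR n i = mVal Δ n i - 1 ∨
        2 * mHat Δ TL TR n i = mVal Δ n i - 2)) ∧
  G = ∑ᶠ n ∈ fermionicIndex p L Δ, fermionicTerm p ℓ Δ TL TR n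

end

noncomputable section

/-! A vertex of a path is straight or a turn; only straight vertices carry weight, vertex number `i`
giving `q^{i/2}`. The proof is a recursion on the height of the strip, refined by the number of
straight vertices. Paths of length `L` in the strip `1..p+1` with `M` straight vertices contract to
paths of length `M` in the strip `1..p`. If a short path has `K` straight vertices, the long paths
above it contribute `q^{M(M-K)/2 + n T^R} [n + m̂; n]'_{q²}` with `2n = L - 2M + K` (`stepCoeff`).

No bijection is constructed. `stateSum_contract` compares the transfer recursions in the last vertex
on both sides. If the lower end of the last edge is odd, they match by the `q`-Pascal rule; if it is
even, the forbidden valley removes one term and the binomials agree as they stand. The parities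
`T^L, T^R` record this alternative at the two ends.

Contraction moves both boundary edges one step towards the border of the strip. An edge pushed
outside is reflected back, which trades a straight vertex for a turn and shifts `K` by one
(`stateSum_step`). These shifts are the unit second differences of `Δ`, and the ones on the left
produce `-m_ℓ/2`.

On the fermionic side `m_i - 2m_{i+1} + m_{i+2}` is `2n_{i+1}` minus the same difference of `Δ`.
Thus `(m_0, m_1, m_2)` plays the role of `(L, M, K)`, and splitting off `n_1` is one step of the
recursion (`fermionicTerm_consN`). Negative `m_1` does not contribute (`mVal_one_nonneg`). The
induction `stateSum_eq_fermionic` starts from the zigzag in the strip `1..2`. -/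

/-! ### Powers of `q` and modified Gaussian binomials. -/

theorem qPow_mul_qPow (r s : ℚ) : qPow r * qPow s = qPow (r + s) := by
  simp [qPow, HahnSeries.single_mul_single]

theorem qPow_zero : qPow 0 = 1 := rfl

theorem qPow_pow (r : ℚ) (n : ℕ) : qPow r ^ n = qPow (n * r) := by
  simp [qPow, HahnSeries.single_pow]

theorem qFactorial_ne_zero {r : ℚ} (hr : 0 < r) (n : ℕ) : qFactorial (qPow r) n ≠ 0 := by
  refine Finset.prod_ne_zero_iff.2 fun i hi => ?_
  rw [qPow_pow, ← qPow_zero, sub_ne_zero]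
  intro h
  have h1 : (0 : ℚ) < i * r := by
    have : (1 : ℚ) ≤ i := by exact_mod_cast (Finset.mem_Icc.1 hi).1
    positivity
  have h2 := congrArg (fun x : QField => x.coeff 0) h
  simp [qPow, HahnSeries.coeff_single_of_ne h1.ne] at h2

theorem qFactorial_succ (x : QField) (n : ℕ) :
    qFactorial x (n + 1) = qFactorial x n * (1 - x ^ (n + 1)) := by
  rw [qFactorial, Finset.prod_Icc_succ_top (by omega), qFactorial]

theorem qFactorial_zero (x : QField) : qFactorial x 0 = 1 := by simp [qFactorial]

theorem qBinomMod_of_neg (x : QField) {n : ℤ} (hn : n < 0) (m : ℤ) : qBinomMod x n m = 0 := by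
  rw [qBinomMod, if_neg (by omega), if_neg (by omega)]

theorem qBinomMod_of_pos_of_neg (x : QField) {n m : ℤ} (hn : n ≠ 0) (hm : m < 0) :
    qBinomMod x n m = 0 := by
  rw [qBinomMod, if_neg (by omega), if_neg (by omega)]

theorem qBinomMod_zero_left {r : ℚ} (hr : 0 < r) {m : ℤ} (hm : -1 ≤ m) :
    qBinomMod (qPow r) 0 m = 1 := by
  rw [qBinomMod]
  split_ifs with h1 h2
  · simp [qFactorial_zero, qFactorial_ne_zero hr]
  · rfl
  · omega

theorem qBinomMod_zero_right {r : ℚ} (hr : 0 < r) {n : ℤ} (hn : 0 ≤ n) :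
    qBinomMod (qPow r) n 0 = 1 := by
  rw [qBinomMod, if_pos ⟨hn, le_rfl⟩]
  simp [qFactorial_zero, qFactorial_ne_zero hr]

/-- The `q`-Pascal rule for the modified Gaussian binomials. -/
theorem qBinomMod_pascal {r : ℚ} (hr : 0 < r) (n : ℤ) {m : ℤ} (hm : 0 ≤ m) :
    qBinomMod (qPow r) n m =
      qPow (n * r) * qBinomMod (qPow r) n (m - 1) + qBinomMod (qPow r) (n - 1) m := by
  rcases lt_trichotomy n 0 with hn | rfl | hn
  · simp [qBinomMod_of_neg _ hn, qBinomMod_of_neg _ (show n - 1 < 0 by omega)]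
  -- For `m = 0` this needs the conventional value `1` at the pair `(0, -1)`.
  · rw [qBinomMod_zero_left hr (by omega), qBinomMod_zero_left hr (by omega),
      qBinomMod_of_neg _ (by omega)]
    simp [qPow_zero]
  · rcases hm.eq_or_lt with rfl | hm
    · rw [qBinomMod_of_pos_of_neg _ hn.ne' (show (0 : ℤ) - 1 < 0 by omega),
        qBinomMod_zero_right hr hn.le, qBinomMod_zero_right hr (by omega)]
      simp
    · obtain ⟨n, rfl⟩ : ∃ k : ℕ, n = k + 1 := ⟨(n - 1).toNat, by omega⟩
      obtain ⟨m, rfl⟩ : ∃ k : ℕ, m = k + 1 := ⟨(m - 1).toNat, by omega⟩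
      rw [qBinomMod, qBinomMod, qBinomMod, if_pos (by omega), if_pos (by omega),
        if_pos (by omega)]
      have e1 : ((n : ℤ) + 1 + (m + 1)).toNat = n + m + 1 + 1 := by omega
      have e2 : ((n : ℤ) + 1 + (m + 1 - 1)).toNat = n + m + 1 := by omega
      have e3 : ((n : ℤ) + 1 - 1 + (m + 1)).toNat = n + m + 1 := by omega
      have e4 : ((n : ℤ) + 1).toNat = n + 1 := by omega
      have e5 : ((m : ℤ) + 1).toNat = m + 1 := by omega
      have e6 : ((m : ℤ) + 1 - 1).toNat = m := by omega
      have e7 : ((n : ℤ) + 1 - 1).toNat = n := by omega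
      rw [e1, e2, e3, e4, e5, e6, e7]
      have f1 := qFactorial_ne_zero hr n
      have f2 := qFactorial_ne_zero hr m
      have f3 := qFactorial_ne_zero hr (n + 1)
      have f4 := qFactorial_ne_zero hr (m + 1)
      have h0 : qPow (((n : ℤ) + 1 : ℤ) * r) = qPow r ^ (n + 1) := by
        rw [qPow_pow]; push_cast; rfl
      rw [h0]
      rw [qFactorial_succ] at f3 f4
      rw [qFactorial_succ _ n, qFactorial_succ _ m, qFactorial_succ _ (n + m + 1)]
      have g3 := right_ne_zero_of_mul f3
      have g4 := right_ne_zero_of_mul f4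
      field_simp
      ring

/-! ### The coefficient of one contraction. -/

/-- The weight of one step of the fermionic recursion. -/
def stepCoeff (TL TR L M K : ℤ) : QField :=
  if Even (L - 2 * M + K) then
    qPow ((M * (M - K) : ℤ) / 2 + ((L - 2 * M + K) / 2 * TR : ℤ)) *
      qBinomMod (qPow 2) ((L - 2 * M + K) / 2) ((M - TL - TR) / 2)
  else 0

theorem stepCoeff_of_eq {TL TR L M K n : ℤ} (h : L - 2 * M + K = 2 * n) :
    stepCoeff TL TR L M K = qPow ((M * (M - K) : ℤ) / 2 + (n * TR : ℤ)) *
      qBinomMod (qPow 2) n ((M - TL - TR) / 2) := by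
  rw [stepCoeff, h, if_pos (even_two_mul n)]
  simp

theorem stepCoeff_of_lt {TL TR L M K : ℤ} (h : L - 2 * M + K < 0) :
    stepCoeff TL TR L M K = 0 := by
  rw [stepCoeff, qBinomMod_of_neg _ (by omega)]
  simp

theorem stepCoeff_of_neg {TL TR L M K : ℤ} (h : L - 2 * M + K ≠ 0) (hT : M - TL - TR < 0) :
    stepCoeff TL TR L M K = 0 := by
  rw [stepCoeff]
  split_ifs with he
  · rw [qBinomMod_of_pos_of_neg _ _ (by omega), mul_zero]
    obtain ⟨c, hc⟩ := he
    omega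
  · rfl

theorem stepCoeff_zero_of_even {L K : ℤ} (h : Even (L + K)) (h0 : 0 ≤ L + K) :
    stepCoeff 0 0 L 0 K = 1 := by
  obtain ⟨n, hn⟩ := h
  rw [stepCoeff_of_eq (n := n) (by omega), show ((0 : ℤ) - 0 - 0) / 2 = 0 from rfl,
    qBinomMod_zero_right two_pos (by omega)]
  simp [qPow_zero]

/-- `L + K` is unchanged, so the binomial is too; only the quadratic exponent moves. This handles a
turn at the last vertex of the short path. -/
theorem stepCoeff_succ (TL TR L M K : ℤ) :
    stepCoeff TL TR L M K = qPow (M / 2) * stepCoeff TL TR (L - 1) M (K + 1) := by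
  by_cases h : Even (L - 2 * M + K)
  · obtain ⟨n, hn⟩ := h
    rw [stepCoeff_of_eq (n := n) (by omega), stepCoeff_of_eq (n := n) (by omega), ← mul_assoc,
      qPow_mul_qPow]
    congr 2
    push_cast
    ring
  · rw [stepCoeff, stepCoeff, if_neg h, if_neg (by convert h using 2; ring), mul_zero]

/-- The `q`-Pascal rule: lowering `M` and raising `T^R` from `0` to `1` together lower `m̂` by one.
The hypothesis gives `m̂ ≥ 0`; the rule fails at `(0, -1)`. -/
theorem stepCoeff_pascal_even (TL L M K : ℤ) (h : 0 ≤ M - TL) :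
    qPow (M / 2) * stepCoeff TL 0 L M (K + 1) =
      qPow (L / 2) * stepCoeff TL 1 (L - 1) (M - 1) K + stepCoeff TL 0 (L - 1) M K := by
  by_cases h2 : Even (L - 2 * M + (K + 1))
  · obtain ⟨n, hn⟩ := h2
    rw [stepCoeff_of_eq (n := n) (by omega), stepCoeff_of_eq (n := n) (by omega),
      stepCoeff_of_eq (n := n - 1) (by omega), qBinomMod_pascal two_pos n (by omega),
      show (M - 1 - TL - 1) / 2 = (M - TL - 0) / 2 - 1 by omega, mul_add, mul_add]
    simp only [← mul_assoc, qPow_mul_qPow]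
    have hL : (L : ℚ) = 2 * n + 2 * M - K - 1 := by
      have : L = 2 * n + 2 * M - K - 1 := by omega
      rw [this]; push_cast; ring
    congr 3
    · push_cast
      rw [hL]
      ring
    · push_cast
      ring
  · rw [stepCoeff, stepCoeff, stepCoeff, if_neg h2, if_neg, if_neg]
    · simp
    · intro h3; apply h2; obtain ⟨n, hn⟩ := h3; exact ⟨n + 1, by omega⟩
    · intro h3; apply h2; obtain ⟨n, hn⟩ := h3; exact ⟨n, by omega⟩

/-- Lowering `M` and `T^R` together leaves `m̂` fixed, so one term suffices; the missing one is the
forbidden valley. -/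
theorem stepCoeff_pascal_odd (TL L M K : ℤ) :
    qPow (M / 2) * stepCoeff TL 1 L M (K + 1) =
      qPow (L / 2) * stepCoeff TL 0 (L - 1) (M - 1) K := by
  by_cases h2 : Even (L - 2 * M + (K + 1))
  · obtain ⟨n, hn⟩ := h2
    rw [stepCoeff_of_eq (n := n) (by omega), stepCoeff_of_eq (n := n) (by omega),
      show (M - TL - 1) / 2 = (M - 1 - TL - 0) / 2 by omega]
    simp only [← mul_assoc, qPow_mul_qPow]
    have hL : (L : ℚ) = 2 * n + 2 * M - K - 1 := by
      have : L = 2 * n + 2 * M - K - 1 := by omega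
      rw [this]; push_cast; ring
    congr 2
    push_cast
    rw [hL]
    ring
  · rw [stepCoeff, stepCoeff, if_neg h2, if_neg]
    · simp
    · intro h3; apply h2; obtain ⟨n, hn⟩ := h3; exact ⟨n, by omega⟩

/-! ### The path sum and its linearity in `φ`. -/

/-- Transfer-matrix form of the path sum. A pair `(d, k)` stands for the edge between the heights
`k` and `k + 1`, run upwards if `d` is true and downwards otherwise. The paths have `j` vertices of
heights between `1` and `p`, start with the edge `(e, c)` and end with `(d, k)`; each contributes
its weight times the value of `φ` at its number of straight vertices. -/
def stateSum (p : ℤ) (e : Bool) (c : ℤ) : ℕ → Bool → ℤ → (ℤ → QField) → QField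
  | 0, d, k, φ => if e = d ∧ c = k then φ 0 else 0
  | j + 1, false, k, φ =>
    if 0 ≤ k ∧ k < p then
      qPow (j / 2) * stateSum p e c j false (k + 1) (fun M => φ (M + 1)) + stateSum p e c j true k φ
    else 0
  | j + 1, true, k, φ =>
    if 1 ≤ k ∧ k ≤ p then
      qPow (j / 2) * stateSum p e c j true (k - 1) (fun M => φ (M + 1)) +
        (if Even k then 0 else stateSum p e c j false k φ)
    else 0

section
variable {p c : ℤ} {e : Bool}

theorem stateSum_zero (d : Bool) (k : ℤ) (φ : ℤ → QField) :
    stateSum p e c 0 d k φ = if e = d ∧ c = k then φ 0 else 0 := rfl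

theorem stateSum_down (j : ℕ) {k : ℤ} (hk : 0 ≤ k ∧ k < p) (φ : ℤ → QField) :
    stateSum p e c (j + 1) false k φ =
      qPow (j / 2) * stateSum p e c j false (k + 1) (fun M => φ (M + 1)) +
        stateSum p e c j true k φ := by
  rw [stateSum, if_pos hk]

theorem stateSum_up (j : ℕ) {k : ℤ} (hk : 1 ≤ k ∧ k ≤ p) (φ : ℤ → QField) :
    stateSum p e c (j + 1) true k φ =
      qPow (j / 2) * stateSum p e c j true (k - 1) (fun M => φ (M + 1)) +
        (if Even k then 0 else stateSum p e c j false k φ) := by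
  rw [stateSum, if_pos hk]

theorem stateSum_down_of_not (j : ℕ) {k : ℤ} (hk : ¬ (0 ≤ k ∧ k < p)) (φ : ℤ → QField) :
    stateSum p e c (j + 1) false k φ = 0 := by
  rw [stateSum, if_neg hk]

theorem stateSum_up_of_not (j : ℕ) {k : ℤ} (hk : ¬ (1 ≤ k ∧ k ≤ p)) (φ : ℤ → QField) :
    stateSum p e c (j + 1) true k φ = 0 := by
  rw [stateSum, if_neg hk]

theorem stateSum_congr (j : ℕ) : ∀ (d : Bool) (k : ℤ) {φ ψ : ℤ → QField},
    (∀ M : ℤ, 0 ≤ M → M ≤ j → φ M = ψ M) → stateSum p e c j d k φ = stateSum p e c j d k ψ := by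
  induction j with
  | zero => intro d k φ ψ h; rw [stateSum_zero, stateSum_zero, h 0 le_rfl (by simp)]
  | succ j ih =>
    intro d k φ ψ h
    have h1 : ∀ M : ℤ, 0 ≤ M → M ≤ j → φ M = ψ M := fun M h0 hj => h M h0 (by push_cast; omega)
    have h2 : ∀ M : ℤ, 0 ≤ M → M ≤ j → φ (M + 1) = ψ (M + 1) := fun M h0 hj =>
      h _ (by omega) (by push_cast; omega)
    cases d
    · rw [stateSum, stateSum, ih _ _ h1, ih _ _ h2]
    · rw [stateSum, stateSum, ih _ _ h1, ih _ _ h2]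

theorem stateSum_add (j : ℕ) : ∀ (d : Bool) (k : ℤ) (φ ψ : ℤ → QField),
    stateSum p e c j d k (fun M => φ M + ψ M) =
      stateSum p e c j d k φ + stateSum p e c j d k ψ := by
  induction j with
  | zero => intro d k φ ψ; simp only [stateSum_zero]; split_ifs <;> simp
  | succ j ih =>
    intro d k φ ψ
    cases d
    · simp only [stateSum]
      rw [ih, ih]
      split_ifs <;> ring
    · simp only [stateSum]
      rw [ih, ih]
      split_ifs <;> ring

theorem stateSum_mul (j : ℕ) : ∀ (d : Bool) (k : ℤ) (x : QField) (φ : ℤ → QField),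
    stateSum p e c j d k (fun M => x * φ M) = x * stateSum p e c j d k φ := by
  induction j with
  | zero => intro d k φ ψ; simp only [stateSum_zero]; split_ifs <;> simp
  | succ j ih =>
    intro d k φ ψ
    cases d
    · simp only [stateSum]
      rw [ih, ih]
      split_ifs <;> ring
    · simp only [stateSum]
      rw [ih, ih]
      split_ifs <;> ring

theorem stateSum_of_zero (j : ℕ) (d : Bool) (k : ℤ) {φ : ℤ → QField}
    (h : ∀ M : ℤ, 0 ≤ M → M ≤ j → φ M = 0) : stateSum p e c j d k φ = 0 := by
  rw [stateSum_congr (ψ := fun M => 0 * φ M) j d k (fun M h0 hj => by rw [h M h0 hj, zero_mul]),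
    stateSum_mul, zero_mul]

theorem stateSum_sum {ι : Type*} (S : Finset ι) (j : ℕ) (d : Bool) (k : ℤ)
    (φ : ι → ℤ → QField) :
    stateSum p e c j d k (fun M => ∑ i ∈ S, φ i M) = ∑ i ∈ S, stateSum p e c j d k (φ i) := by
  classical
  induction S using Finset.induction_on with
  | empty => simpa using stateSum_of_zero (φ := fun _ => 0) j d k (fun _ _ _ => rfl)
  | insert a S ha ih =>
    simp only [Finset.sum_insert ha]
    rw [stateSum_add, ih]

/-- Expansion of a path sum with respect to the number of straight vertices. -/
theorem stateSum_expand (j : ℕ) (d : Bool) (k : ℤ) (φ : ℤ → QField) {B : ℕ} (hB : j < B) :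
    stateSum p e c j d k φ =
      ∑ N ∈ Finset.range B, φ N * stateSum p e c j d k (fun K => if K = N then 1 else 0) := by
  simp only [← stateSum_mul, ← stateSum_sum]
  refine stateSum_congr j d k fun M h0 hj => ?_
  rw [Finset.sum_eq_single M.toNat]
  · simp [Int.toNat_of_nonneg h0]
  · intro b _ hb
    rw [if_neg (by omega), mul_zero]
  · intro h
    exact absurd (Finset.mem_range.2 (by omega)) h

end

/-! ### Contraction to a lower strip. -/

/-- The edge of `(1, p)`-restricted paths to which the initial edge `(d, k)` is contracted. -/
def contractL (d : Bool) (k : ℤ) : ℤ := if d then k - 1 else k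

/-- The edge of `(1, p)`-restricted paths to which the final edge `(d, k)` is contracted. -/
def contractR (d : Bool) (k : ℤ) : ℤ := if d then k else k - 1

/-- The contraction of `(1, p + 1)`-restricted paths to `(1, p)`-restricted paths whose length
is the number of straight vertices. -/
theorem stateSum_contract {p c : ℤ} (hc : 1 ≤ c ∧ c ≤ p) (e : Bool) (j : ℕ) :
    ∀ (N : ℕ) (d : Bool) (k : ℤ), (if d then 0 ≤ k ∧ k ≤ p else 1 ≤ k ∧ k ≤ p + 1) →
      stateSum (p + 1) e c j d k (fun K => if K = (N : ℤ) - 1 then 1 else 0) =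
        stateSum p e (contractL e c) N d (contractR d k)
          (stepCoeff ((c - 1) % 2) ((k - 1) % 2) ((j : ℤ) - 1) ((N : ℤ) - 1)) := by
  -- There are no paths with `-1` straight vertices; on the right `M = -1` makes `m̂` negative while
  -- `L - 2M + K = j + 1 ≠ 0`.
  have hzero : ∀ (j : ℕ) (d : Bool) (k : ℤ),
      stateSum (p + 1) e c j d k (fun K => if K = ((0 : ℕ) : ℤ) - 1 then 1 else 0) =
        stateSum p e (contractL e c) 0 d (contractR d k)
          (stepCoeff ((c - 1) % 2) ((k - 1) % 2) ((j : ℤ) - 1) (((0 : ℕ) : ℤ) - 1)) := by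
    intro j d k
    rw [stateSum_of_zero, stateSum_of_zero]
    · intro M h0 h1
      exact stepCoeff_of_neg (by push_cast at *; omega) (by push_cast; omega)
    · intro M h0 h1
      exact if_neg (by push_cast; omega)
  -- Here the last vertex would lie outside the strip on either side.
  have hbd : ∀ (j N : ℕ) (d : Bool) (k : ℤ), (if d then k = 0 else k = p + 1) →
      stateSum (p + 1) e c j d k (fun K => if K = ((N + 1 : ℕ) : ℤ) - 1 then 1 else 0) =
        stateSum p e (contractL e c) (N + 1) d (contractR d k)
          (stepCoeff ((c - 1) % 2) ((k - 1) % 2) ((j : ℤ) - 1) (((N + 1 : ℕ) : ℤ) - 1)) := by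
    intro j N d k hk
    cases d
    · simp only [Bool.false_eq_true, if_false] at hk
      rw [stateSum_down_of_not N (by simp [contractR]; omega)]
      cases j
      · rw [stateSum_zero, if_neg (by omega)]
      · rw [stateSum_down_of_not _ (by omega)]
    · simp only [if_true] at hk
      rw [stateSum_up_of_not N (by simp [contractR]; omega)]
      cases j
      · rw [stateSum_zero, if_neg (by omega)]
      · rw [stateSum_up_of_not _ (by omega)]
  induction j with
  | zero =>
    intro N d k hk
    rcases N with _ | N
    · exact hzero _ _ _
    by_cases hb : if d then k = 0 else k = p + 1
    · exact hbd _ _ _ _ hb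
    rcases N with _ | N
    -- A bare edge has `L = -1` and contracts to one vertex passed straight: parity kills `K = 0`,
    -- and `K = 1` gives `n = 0`. If both parities are `1` then `m̂ = -1`, so the modified binomial
    -- is essential.
    · have hφ0 : stepCoeff ((c - 1) % 2) ((k - 1) % 2) (((0 : ℕ) : ℤ) - 1)
          (((0 + 1 : ℕ) : ℤ) - 1) 0 = 0 := by
        rw [stepCoeff, if_neg]
        simp
      have hφ1 : stepCoeff ((c - 1) % 2) ((k - 1) % 2) (((0 : ℕ) : ℤ) - 1)
          (((0 + 1 : ℕ) : ℤ) - 1) (0 + 1) = 1 := by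
        rw [stepCoeff_of_eq (n := 0) (by simp), qBinomMod_zero_left two_pos (by push_cast; omega)]
        simp [qPow_zero]
      cases d
      · simp only [Bool.false_eq_true, if_false] at hk hb
        rw [stateSum_down 0 (by simp [contractR]; omega)]
        simp only [stateSum_zero, hφ0, hφ1]
        cases e <;> simp [contractL, contractR, qPow_zero]
      · simp only [if_true] at hk hb
        rw [stateSum_up 0 (by simp [contractR]; omega)]
        simp only [stateSum_zero, hφ0, hφ1]
        cases e <;> simp [contractL, contractR, qPow_zero]
    · rw [stateSum_of_zero, stateSum_of_zero]
      · intro M h0 h1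
        exact stepCoeff_of_lt (by push_cast at *; omega)
      · intro M h0 h1
        exact if_neg (by push_cast at *; omega)
  | succ j ih =>
    intro N d k hk
    rcases N with _ | N
    · exact hzero _ _ _
    by_cases hb : if d then k = 0 else k = p + 1
    · exact hbd _ _ _ _ hb
    have hδ : (fun M : ℤ => if M + 1 = ((N + 1 : ℕ) : ℤ) - 1 then (1 : QField) else 0) =
        fun M => if M = (N : ℤ) - 1 then 1 else 0 := by
      funext M
      congr 1
      push_cast
      exact propext ⟨by omega, by omega⟩
    have hL : ((j + 1 : ℕ) : ℤ) - 1 = j := by push_cast; ring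
    have hM : ((N + 1 : ℕ) : ℤ) - 1 = N := by push_cast; ring
    have key1 : ∀ T : ℤ, stepCoeff ((c - 1) % 2) T j N = fun μ => qPow (N / 2) *
        stepCoeff ((c - 1) % 2) T ((j : ℤ) - 1) N (μ + 1) := fun T => by
      funext μ
      simpa using stepCoeff_succ ((c - 1) % 2) T j N μ
    have key2 : ∀ (d : Bool) (k' k'' : ℤ), k' % 2 = (k - 1) % 2 + 1 ∨ (k - 1) % 2 = k' % 2 + 1 →
        (contractL e c = k'' → e = d → c = k) →
        qPow (N / 2) * stateSum p e (contractL e c) N d k''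
          (fun μ => stepCoeff ((c - 1) % 2) ((k - 1) % 2) j N (μ + 1)) =
        qPow (j / 2) * stateSum p e (contractL e c) N d k''
          (stepCoeff ((c - 1) % 2) (k' % 2) ((j : ℤ) - 1) ((N : ℤ) - 1)) +
        if Even k then 0 else stateSum p e (contractL e c) N d k''
          (stepCoeff ((c - 1) % 2) ((k - 1) % 2) ((j : ℤ) - 1) N) := by
      intro d k' k'' hk' hst
      by_cases hk2 : Even k
      · rw [if_pos hk2, add_zero]
        have h1 : (k - 1) % 2 = 1 := by obtain ⟨r, hr⟩ := hk2; omega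
        have h2 : k' % 2 = 0 := by omega
        rw [← stateSum_mul, ← stateSum_mul, h1, h2]
        refine stateSum_congr _ _ _ fun μ _ _ => ?_
        simpa using stepCoeff_pascal_odd ((c - 1) % 2) j N μ
      · rw [if_neg hk2]
        have h1 : (k - 1) % 2 = 0 := by rw [Int.not_even_iff_odd] at hk2; obtain ⟨r, hr⟩ := hk2; omega
        have h2 : k' % 2 = 1 := by omega
        rw [← stateSum_mul, ← stateSum_mul, ← stateSum_add, h1, h2]
        -- For `N = 0` the Pascal rule needs `T^L = 0`. The sum survives only if `c = k`, which is
        -- odd here.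
        rcases N with _ | N
        · rw [stateSum_zero, stateSum_zero]
          split_ifs with h3
          · have := hst h3.2 h3.1
            simpa using stepCoeff_pascal_even ((c - 1) % 2) j (0 : ℕ) 0 (by push_cast; omega)
          · rfl
        · refine stateSum_congr _ _ _ fun μ _ _ => ?_
          simpa using stepCoeff_pascal_even ((c - 1) % 2) j (N + 1 : ℕ) μ (by push_cast; omega)
    cases d
    · simp only [Bool.false_eq_true, if_false] at hk hb
      rw [stateSum_down j (by omega), hδ, ih N false (k + 1) (by simp; omega),
        ih (N + 1) true k (by simp; omega), hL, hM,
        stateSum_down (p := p) N (by simp [contractR]; omega),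
        stateSum_up (p := p) N (by simp [contractR]; omega)]
      have e1 : contractR false (k + 1) = k := by simp [contractR]
      have e2 : contractR false k = k - 1 := rfl
      have e3 : contractR true k = k := rfl
      rw [e1, e2, e3, sub_add_cancel, key2 false (k + 1 - 1) k (by omega)
        (by rintro h rfl; simpa [contractL] using h)]
      conv_rhs => rw [key1, stateSum_mul]
      ring
    · simp only [if_true] at hk hb
      rw [stateSum_up j (by omega), hδ, ih N true (k - 1) (by simp; omega),
        ih (N + 1) false k (by simp; omega), hL, hM,
        stateSum_down (p := p) N (by simp [contractR]; omega),
        stateSum_up (p := p) N (by simp [contractR]; omega)]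
      have e1 : contractR true (k - 1) = k - 1 := rfl
      have e2 : contractR false k = k - 1 := rfl
      have e3 : contractR true k = k := rfl
      rw [e1, e2, e3, sub_add_cancel, key2 true (k - 1 - 1) (k - 1) (by omega)
        (by rintro h rfl; simpa [contractL] using h)]
      conv_rhs => rw [key1, stateSum_mul]
      split_ifs <;> ring

/-! ### Reflection of boundary edges that leave the strip. -/

/-- The initial edge with direction `e` from whose far end the strip has `l` edges. -/
def edgeL (p : ℤ) (e : Bool) (l : ℤ) : ℤ := if e then l else p - l

/-- The final edge with direction `d` from whose near end the strip has `r` edges. -/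
def edgeR (p : ℤ) (d : Bool) (r : ℤ) : ℤ := if d then p - r else r

theorem contractL_edgeL (p l : ℤ) (e : Bool) :
    contractL e (edgeL (p + 1) e l) = edgeL p e (l - 1) := by
  cases e <;> simp [contractL, edgeL]
  ring

theorem contractR_edgeR (p r : ℤ) (d : Bool) :
    contractR d (edgeR (p + 1) d r) = edgeR p d (r - 1) := by
  cases d <;> simp [contractR, edgeR]
  ring

theorem stateSum_down_eq_zero {p c : ℤ} {e : Bool} {j : ℕ} {k : ℤ} (hk : k < 0 ∨ p ≤ k)
    (h : j ≠ 0 ∨ ¬ (e = false ∧ c = k)) (φ : ℤ → QField) : stateSum p e c j false k φ = 0 := by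
  rcases j with _ | j
  · rw [stateSum_zero, if_neg (h.resolve_left (by simp))]
  · exact stateSum_down_of_not j (by omega) φ

theorem stateSum_up_eq_zero {p c : ℤ} {e : Bool} {j : ℕ} {k : ℤ} (hk : k < 1 ∨ p < k)
    (h : j ≠ 0 ∨ ¬ (e = true ∧ c = k)) (φ : ℤ → QField) : stateSum p e c j true k φ = 0 := by
  rcases j with _ | j
  · rw [stateSum_zero, if_neg (h.resolve_left (by simp))]
  · exact stateSum_up_of_not j (by omega) φ

/-- Reflecting a final edge that leaves the strip. -/
theorem stateSum_reflectR {p c : ℤ} (hp : 1 ≤ p) {e : Bool} (j : ℕ) (d : Bool)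
    (h : j ≠ 0 ∨ ¬ (e = !d ∧ c = edgeR p d 0)) (φ : ℤ → QField) :
    stateSum p e c (j + 1) d (edgeR p d 0) φ =
      qPow (j / 2) * stateSum p e c (j + 1) (!d) (edgeR p (!d) (p - 1)) (fun K => φ (K + 1)) := by
  -- Outside the case excluded by `h`, a path leaves the strip only through a straight last vertex,
  -- and the reflected edge makes a turn there. A valley so created has height `1`, which is odd.
  cases d
  · have e1 : edgeR p false 0 = 0 := rfl
    have e2 : edgeR p (!false) (p - 1) = 1 := by simp [edgeR]
    rw [e1] at h ⊢
    rw [e2, Bool.not_false, stateSum_down j (by omega), stateSum_up j (by omega),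
      stateSum_up_eq_zero (k := 0) (by omega) h, stateSum_up_eq_zero (k := 1 - 1) (by omega) h]
    simp
  · have e1 : edgeR p true 0 = p := by simp [edgeR]
    have e2 : edgeR p (!true) (p - 1) = p - 1 := rfl
    rw [e1] at h ⊢
    rw [e2, Bool.not_true, stateSum_down j (by omega), stateSum_up j (by omega), sub_add_cancel,
      stateSum_down_eq_zero (k := p) (by omega) h, stateSum_down_eq_zero (k := p) (by omega) h]
    simp

/-- Reflecting an initial edge that comes from outside the strip. -/
theorem stateSum_reflectL {p : ℤ} (e : Bool) (j : ℕ) :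
    ∀ (d : Bool) (k : ℤ), (if d then 0 ≤ k ∧ k ≤ p - 1 else 1 ≤ k ∧ k ≤ p) → ∀ φ : ℤ → QField,
      stateSum p e (edgeL p e 0) (j + 1) d k φ =
        stateSum p (!e) (edgeL p (!e) (p - 1)) (j + 1) d k (fun K => φ (K + 1)) := by
  -- The first vertex has weight `0`, so exchanging straight and turn there costs no power of `q`.
  induction j with
  | zero =>
    intro d k hk φ
    cases d <;> cases e <;> simp [edgeL, stateSum, qPow_zero] at hk ⊢ <;> grind
  | succ j ih =>
    intro d k hk φ
    cases d
    · simp only [Bool.false_eq_true, if_false] at hk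
      by_cases hkp : k = p
      · rw [stateSum_down_of_not _ (by omega), stateSum_down_of_not _ (by omega)]
      · rw [stateSum_down (j + 1) (k := k) (by omega), stateSum_down (j + 1) (k := k) (by omega),
          ih false _ (by simp; omega),
          ih true _ (by simp; omega)]
    · simp only [if_true] at hk
      by_cases hkp : k = 0
      · rw [stateSum_up_of_not _ (by omega), stateSum_up_of_not _ (by omega)]
      · rw [stateSum_up (j + 1) (k := k) (by omega), stateSum_up (j + 1) (k := k) (by omega),
          ih true _ (by simp; omega)]
        by_cases h2 : Even k
        · simp [h2]
        · rw [ih false _ (by simp; omega)]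

/-- The direction of the contracted edge. -/
def nextDir (e : Bool) (l : ℤ) : Bool := if l = 1 then !e else e

/-- The position of the contracted edge, in a strip of height `p`. -/
def nextPos (p l : ℤ) : ℤ := if l = 1 then p - 1 else l - 1

theorem stateSum_reflectL' {p : ℤ} (e : Bool) (l : ℤ) (j : ℕ)
    {d : Bool} {k : ℤ} (hk : 1 ≤ k ∧ k ≤ p - 1) (φ : ℤ → QField) :
    stateSum p e (edgeL p e (l - 1)) (j + 1) d k φ =
      stateSum p (nextDir e l) (edgeL p (nextDir e l) (nextPos p l)) (j + 1) d k
        (fun K => φ (K + if l = 1 then 1 else 0)) := by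
  by_cases h : l = 1
  · subst h
    rw [sub_self, stateSum_reflectL e j d k (by cases d <;> simp <;> omega)]
    simp [nextDir, nextPos]
  · simp [nextDir, nextPos, h]

/-- One step of the fermionic recursion. -/
theorem stateSum_step {p : ℤ} (hp : 2 ≤ p) {l r : ℤ} (hl : 1 ≤ l ∧ l ≤ p) (hr : 1 ≤ r ∧ r ≤ p)
    (e d : Bool) (L M : ℕ) :
    stateSum (p + 1) e (edgeL (p + 1) e l) (L + 1) d (edgeR (p + 1) d r)
        (fun K => if K = M then 1 else 0) =
      stateSum p (nextDir e l) (edgeL p (nextDir e l) (nextPos p l)) (M + 1)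
        (nextDir d r) (edgeR p (nextDir d r) (nextPos p r))
        (fun K => qPow (if r = 1 then M / 2 else 0) *
          stepCoeff ((edgeL (p + 1) e l - 1) % 2) ((edgeR (p + 1) d r - 1) % 2) L M
            (K + (if l = 1 then 1 else 0) + (if r = 1 then 1 else 0))) := by
  have hR : 1 ≤ edgeR p (nextDir d r) (nextPos p r) ∧
      edgeR p (nextDir d r) (nextPos p r) ≤ p - 1 := by
    by_cases h : r = 1 <;> cases d <;> simp [edgeR, nextDir, nextPos, h] <;> omega
  have h0 := stateSum_contract (p := p) (c := edgeL (p + 1) e l)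
    (by cases e <;> simp [edgeL] <;> omega) e (L + 1) (M + 1) d (edgeR (p + 1) d r)
    (by cases d <;> simp [edgeR] <;> omega)
  rw [contractL_edgeL, contractR_edgeR] at h0
  simp only [Nat.cast_add, Nat.cast_one, add_sub_cancel_right] at h0
  rw [h0, stateSum_mul]
  by_cases h : r = 1
  swap
  · rw [stateSum_reflectL' e l M (by simpa [nextDir, nextPos, h] using hR)
      (fun K => stepCoeff ((edgeL (p + 1) e l - 1) % 2) ((edgeR (p + 1) d r - 1) % 2) L M K)]
    simp [nextDir, nextPos, h, qPow_zero]
  subst h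
  simp only [if_true, sub_self]
  by_cases h1 : M ≠ 0 ∨ ¬ (e = !d ∧ edgeL p e (l - 1) = edgeR p d 0)
  · rw [stateSum_reflectR (by omega) M d h1]
    have en : nextDir d 1 = !d := by simp [nextDir]
    have ep : nextPos p 1 = p - 1 := by simp [nextPos]
    rw [en, ep] at hR ⊢
    rw [stateSum_reflectL' e l M hR]
  -- The short path is one vertex, entered and left through the same outside edge. Reflecting both
  -- ends keeps the turn but evaluates the coefficient at `K = 2` instead of `0`; the two agree when
  -- both parities vanish.
  · push Not at h1
    obtain ⟨rfl, rfl, h1⟩ := h1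
    obtain rfl : l = 1 := by cases d <;> simp [edgeL, edgeR] at h1 <;> omega
    cases d
    · have e1 : edgeL p (!false) (1 - 1) = 0 := rfl
      have e2 : edgeR p false 0 = 0 := rfl
      have e3 : nextDir (!false) 1 = false := rfl
      have e4 : nextDir false 1 = true := rfl
      have e5 : edgeL p false (nextPos p 1) = 1 := by simp [edgeL, nextPos]
      have e6 : edgeR p true (nextPos p 1) = 1 := by simp [edgeR, nextPos]
      have e7 : edgeL (p + 1) (!false) 1 = 1 := rfl
      have e8 : edgeR (p + 1) false 1 = 1 := rfl
      simp only [e1, e2, e3, e4, e5, e6, e7, e8, if_true]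
      rw [stateSum_down 0 (by omega), stateSum_up 0 (by omega)]
      simp only [stateSum_zero]
      by_cases hL : Even (L : ℤ)
      · have a0 := stepCoeff_zero_of_even (L := L) (K := 0) (by simpa using hL) (by omega)
        have a2 := stepCoeff_zero_of_even (L := L) (K := 2)
          (by simpa [Int.even_add] using hL) (by omega)
        simp [a0, a2, qPow_zero]
      · simp [stepCoeff, hL]
    · have e1 : edgeL p (!true) (1 - 1) = p := by simp [edgeL]
      have e2 : edgeR p true 0 = p := by simp [edgeR]
      have e3 : nextDir (!true) 1 = true := rfl
      have e4 : nextDir true 1 = false := rfl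
      have e5 : edgeL p true (nextPos p 1) = p - 1 := by simp [edgeL, nextPos]
      have e6 : edgeR p false (nextPos p 1) = p - 1 := by simp [edgeR, nextPos]
      have e7 : edgeL (p + 1) (!true) 1 = p := by simp [edgeL]
      have e8 : edgeR (p + 1) true 1 = p := by simp [edgeR]
      simp only [e1, e2, e3, e4, e5, e6, e7, e8, if_true]
      rw [stateSum_down 0 (by omega), stateSum_up 0 (by omega)]
      simp only [stateSum_zero]
      -- The original turn is a valley at height `p`. If `p` is even it is forbidden, and both
      -- parities are `1`, so `m̂ = -1` kills the other side.
      by_cases hp2 : Even p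
      · have a2 : stepCoeff ((p - 1) % 2) ((p - 1) % 2) L 0 2 = 0 := by
          obtain ⟨q, hq⟩ := hp2
          exact stepCoeff_of_neg (by omega) (by omega)
        simp [hp2, a2]
      · have hT : (p - 1) % 2 = 0 := by
          rw [Int.not_even_iff_odd] at hp2; obtain ⟨q, hq⟩ := hp2; omega
        by_cases hL : Even (L : ℤ)
        · have a0 := stepCoeff_zero_of_even (L := L) (K := 0) (by simpa using hL) (by omega)
          have a2 := stepCoeff_zero_of_even (L := L) (K := 2)
            (by simpa [Int.even_add] using hL) (by omega)
          simp [a0, a2, qPow_zero, hT, hp2]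
        · simp [stepCoeff, hL]

/-! ### From sets of paths to the path sum. -/

/-- The valley-restricted paths of length `L` that start with the heights `x, y` and end with the
heights `z, w`. -/
def pathSet (p : ℕ) (x y : ℤ) (L : ℕ) (z w : ℤ) : Set (Fin (L + 3) → ℤ) :=
  {h | IsABFPath h ∧ (∀ i : Fin (L + 1), 1 ≤ ht h i ∧ ht h i ≤ p) ∧ ht h 0 = y ∧
    ht h (Fin.last L) = z ∧ htPrev h 0 = x ∧ htNext h (Fin.last L) = w ∧ IsValleyRestricted h}

theorem restrictedPaths_eq_pathSet (p a b e f L : ℕ) :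
    restrictedPaths p a b e f L = pathSet p ((a : ℤ) + 1 - 2 * e) a L b ((b : ℤ) + 1 - 2 * f) := by
  ext h
  simp only [restrictedPaths, abfPaths, pathSet, Set.mem_ofPred_eq, and_assoc]

section
variable {L : ℕ} (g : Fin (L + 3) → ℤ) (w : ℤ)

/-- The path `g` continued to the height `w`. -/
abbrev extendPath : Fin (L + 1 + 3) → ℤ := Fin.snoc (α := fun _ => ℤ) g w

theorem extendPath_castSucc (i : Fin (L + 3)) : extendPath g w i.castSucc = g i :=
  Fin.snoc_castSucc (α := fun _ => ℤ) w g i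

theorem extendPath_last : extendPath g w (Fin.last (L + 3)) = w :=
  Fin.snoc_last (α := fun _ => ℤ) w g

theorem ht_extendPath_castSucc (i : Fin (L + 1)) : ht (extendPath g w) i.castSucc = ht g i :=
  extendPath_castSucc g w i.castSucc.succ

theorem htPrev_extendPath_castSucc (i : Fin (L + 1)) :
    htPrev (extendPath g w) i.castSucc = htPrev g i :=
  extendPath_castSucc g w _

theorem htNext_extendPath_castSucc (i : Fin (L + 1)) :
    htNext (extendPath g w) i.castSucc = htNext g i :=
  extendPath_castSucc g w i.succ.succ

theorem ht_extendPath_last : ht (extendPath g w) (Fin.last (L + 1)) = htNext g (Fin.last L) :=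
  extendPath_castSucc g w (Fin.last L).succ.succ

theorem htPrev_extendPath_last : htPrev (extendPath g w) (Fin.last (L + 1)) = ht g (Fin.last L) :=
  extendPath_castSucc g w (Fin.last L).castSucc.succ

theorem htNext_extendPath_last : htNext (extendPath g w) (Fin.last (L + 1)) = w :=
  extendPath_last g w

theorem isABFPath_extendPath :
    IsABFPath (extendPath g w) ↔ IsABFPath g ∧ |w - htNext g (Fin.last L)| = 1 := by
  have h1 : ∀ i : Fin (L + 2), extendPath g w i.castSucc.succ = g i.succ := fun i =>
    extendPath_castSucc g w i.succ
  have h2 : ∀ i : Fin (L + 2), extendPath g w i.castSucc.castSucc = g i.castSucc := fun i =>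
    extendPath_castSucc g w i.castSucc
  have h3 : extendPath g w (Fin.last (L + 2)).succ = w := extendPath_last g w
  have h4 : extendPath g w (Fin.last (L + 2)).castSucc = htNext g (Fin.last L) :=
    extendPath_castSucc g w _
  constructor
  · intro h
    refine ⟨fun i => ?_, ?_⟩
    · have := h i.castSucc
      rwa [h1, h2] at this
    · have := h (Fin.last _)
      rwa [h3, h4] at this
  · rintro ⟨h, h'⟩ i
    induction i using Fin.lastCases with
    | last => rwa [h3, h4]
    | cast i => rw [h1, h2]; exact h i

theorem mem_pathSet_extendPath {p : ℕ} {x y z w' : ℤ} :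
    extendPath g w ∈ pathSet p x y (L + 1) z w' ↔
      g ∈ pathSet p x y L (ht g (Fin.last L)) z ∧ w = w' ∧ |w - z| = 1 ∧ (1 ≤ z ∧ z ≤ p) ∧
        (z = ht g (Fin.last L) - 1 ∧ w = z + 1 → ¬ Even z) := by
  have hf : ∀ P : Fin (L + 2) → Prop,
      (∀ i, P i) ↔ (∀ i : Fin (L + 1), P i.castSucc) ∧ P (Fin.last _) := fun P =>
    ⟨fun h => ⟨fun i => h _, h _⟩, fun h i => Fin.lastCases h.2 h.1 i⟩
  have h0 : ht (extendPath g w) 0 = ht g 0 := ht_extendPath_castSucc g w 0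
  have h0' : htPrev (extendPath g w) 0 = htPrev g 0 := htPrev_extendPath_castSucc g w 0
  simp only [pathSet, Set.mem_ofPred_eq, isABFPath_extendPath, IsValleyRestricted, IsValley,
    hf, ht_extendPath_castSucc, htPrev_extendPath_castSucc, htNext_extendPath_castSucc,
    ht_extendPath_last, htPrev_extendPath_last, htNext_extendPath_last, h0, h0']
  constructor
  · rintro ⟨⟨h1, h2⟩, ⟨h3, h4⟩, h5, rfl, h7, rfl, h9, h10⟩
    exact ⟨⟨h1, h3, h5, trivial, h7, rfl, h9⟩, rfl, h2, h4, h10⟩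
  · rintro ⟨⟨h1, h3, h5, -, h7, rfl, h9⟩, rfl, h2, h4, h10⟩
    exact ⟨⟨h1, h2⟩, ⟨h3, h4⟩, h5, rfl, h7, rfl, h9, h10⟩

theorem pathWeight_extendPath :
    pathWeight (extendPath g w) =
      pathWeight g + ((L + 1 : ℕ) : ℚ) / 4 * |((w - ht g (Fin.last L) : ℤ) : ℚ)| := by
  simp only [pathWeight]
  rw [Fin.sum_univ_castSucc, htNext_extendPath_last, htPrev_extendPath_last]
  simp only [htPrev_extendPath_castSucc, htNext_extendPath_castSucc, Fin.val_castSucc,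
    Fin.val_last]
  ring

theorem extendPath_injective : Function.Injective fun g : Fin (L + 3) → ℤ => extendPath g w := by
  intro g g' h
  funext i
  simpa [extendPath_castSucc] using congrFun h i.castSucc

end

theorem pathSet_finite (p : ℕ) (x y : ℤ) (L : ℕ) (z w : ℤ) : (pathSet p x y L z w).Finite := by
  induction L generalizing z w with
  | zero =>
    refine (Set.finite_singleton ![x, y, w]).subset ?_
    rintro h ⟨-, -, rfl, -, rfl, rfl, -⟩
    refine Set.mem_singleton_iff.2 (funext fun i => ?_)
    fin_cases i <;> rfl
  | succ L ih =>
    refine (((ih (z - 1) z).union (ih (z + 1) z)).image fun g => extendPath g w).subset ?_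
    intro h hh
    obtain ⟨g, w', rfl⟩ : ∃ g : Fin (L + 3) → ℤ, ∃ w', h = extendPath g w' :=
      ⟨_, _, (Fin.snoc_init_self (α := fun _ => ℤ) h).symm⟩
    obtain ⟨h1, rfl, -⟩ := (mem_pathSet_extendPath _ _).1 hh
    refine ⟨g, ?_, rfl⟩
    have h3 : |htNext g (Fin.last L) - ht g (Fin.last L)| = 1 := h1.1 (Fin.last (L + 1))
    rw [h1.2.2.2.2.2.1] at h3
    rcases abs_eq (zero_le_one' ℤ) |>.1 h3 with h4 | h4
    · left; rwa [show ht g (Fin.last L) = z - 1 by omega] at h1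
    · right; rwa [show ht g (Fin.last L) = z + 1 by omega] at h1

/-- The generating function of `pathSet`. -/
def pathGF (p : ℕ) (x y : ℤ) (L : ℕ) (z w : ℤ) : QField :=
  ∑ᶠ h ∈ pathSet p x y L z w, qPow (pathWeight h)

theorem pathSet_succ_eq_empty {p : ℕ} {x y : ℤ} {L : ℕ} {z w : ℤ} (hz : ¬ (1 ≤ z ∧ z ≤ p)) :
    pathSet p x y L z w = ∅ := by
  refine Set.eq_empty_of_forall_notMem fun h hh => hz ?_
  obtain ⟨-, h1, -, h2, -⟩ := hh
  exact h2 ▸ h1 (Fin.last L)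

theorem pathSet_succ {p : ℕ} {x y : ℤ} {L : ℕ} {z w : ℤ} (hz : 1 ≤ z ∧ z ≤ p)
    (hw : |w - z| = 1) :
    pathSet p x y (L + 1) z w = (fun g => extendPath g w) ''
      (pathSet p x y L (2 * z - w) z ∪ if w = z + 1 ∧ Even z then ∅ else pathSet p x y L w z) := by
  ext h
  obtain ⟨g, w', rfl⟩ : ∃ g : Fin (L + 3) → ℤ, ∃ w', h = extendPath g w' :=
    ⟨_, _, (Fin.snoc_init_self (α := fun _ => ℤ) h).symm⟩
  have hstep : IsABFPath g → htNext g (Fin.last L) = z →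
      ht g (Fin.last L) = 2 * z - w ∨ ht g (Fin.last L) = w := by
    intro h1 h2
    have h3 : |htNext g (Fin.last L) - ht g (Fin.last L)| = 1 := h1 (Fin.last (L + 1))
    rw [h2] at h3
    have := abs_eq (zero_le_one' ℤ) |>.1 h3
    have := abs_eq (zero_le_one' ℤ) |>.1 hw
    omega
  have hw' := abs_eq (zero_le_one' ℤ) |>.1 hw
  rw [mem_pathSet_extendPath]
  constructor
  · rintro ⟨h1, rfl, h2, h3, h4⟩
    refine ⟨g, ?_, rfl⟩
    rcases hstep h1.1 h1.2.2.2.2.2.1 with h5 | h5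
    · left; rwa [h5] at h1
    · right
      rw [if_neg (fun h6 => h4 ⟨by omega, h6.1⟩ h6.2)]
      rwa [h5] at h1
  · rintro ⟨g', hg', he⟩
    obtain rfl : w = w' := by
      have := congrFun he (Fin.last _)
      simpa [extendPath_last] using this
    obtain rfl := extendPath_injective w he
    rcases hg' with hg' | hg'
    · have h5 := hg'.2.2.2.1
      rw [h5]
      exact ⟨hg', rfl, hw, hz, fun h6 => by omega⟩
    · split_ifs at hg' with h6
      · exact absurd hg' (Set.notMem_empty _)
      · have h5 := hg'.2.2.2.1
        rw [h5]
        exact ⟨hg', rfl, hw, hz, fun h7 h8 => h6 ⟨h7.2, h8⟩⟩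

/-- Drop the last height: vertex number `L + 1` is straight, of weight `2(L + 1)/4`, or a turn, of
weight `0`. -/
theorem pathGF_succ {p : ℕ} {x y : ℤ} {L : ℕ} {z w : ℤ} (hz : 1 ≤ z ∧ z ≤ p)
    (hw : |w - z| = 1) :
    pathGF p x y (L + 1) z w = qPow (((L + 1 : ℕ) : ℚ) / 2) * pathGF p x y L (2 * z - w) z +
      if w = z + 1 ∧ Even z then 0 else pathGF p x y L w z := by
  have hw' := abs_eq (zero_le_one' ℤ) |>.1 hw
  rw [pathGF, pathSet_succ hz hw, finsum_mem_image (extendPath_injective w).injOn,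
    finsum_mem_union]
  · congr 1
    · rw [pathGF, mul_finsum_mem]
      refine finsum_mem_congr rfl fun g hg => ?_
      rw [pathWeight_extendPath, qPow_mul_qPow, hg.2.2.2.1, add_comm]
      have : |((w - (2 * z - w) : ℤ) : ℚ)| = 2 := by
        rw [← Int.cast_abs, show w - (2 * z - w) = 2 * (w - z) by ring, abs_mul, hw]
        norm_num
      rw [this]
      congr 2
      ring
    · split_ifs with h
      · simp
      · refine finsum_mem_congr rfl fun g hg => ?_
        rw [pathWeight_extendPath, hg.2.2.2.1]
        simp
  · rw [Set.disjoint_left]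
    intro g h1 h2
    split_ifs at h2
    · exact h2
    · have h3 := h1.2.2.2.1
      have h4 := h2.2.2.2.1
      omega
  · exact pathSet_finite _ _ _ _ _ _
  · split_ifs
    · exact Set.finite_empty
    · exact pathSet_finite _ _ _ _ _ _

theorem pathGF_zero {p : ℕ} {x y z w : ℤ} (hz : 1 ≤ z ∧ z ≤ p) (hx : |x - y| = 1)
    (hw : |w - z| = 1) :
    pathGF p x y 0 z w = if y = z ∧ ¬ (x = z + 1 ∧ w = z + 1 ∧ Even z) then 1 else 0 := by
  have hset : pathSet p x y 0 z w =
      if y = z ∧ ¬ (x = z + 1 ∧ w = z + 1 ∧ Even z) then {![x, y, w]} else ∅ := by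
    ext h
    have hone : ∀ P : Fin (0 + 1) → Prop, (∀ i, P i) ↔ P 0 := fun P => Fin.forall_fin_one
    have h1 : ht h 0 = h 1 := rfl
    have h2 : htPrev h 0 = h 0 := rfl
    have h3 : htNext h 0 = h 2 := rfl
    have h4 : Fin.last 0 = 0 := rfl
    have e1 : (Fin.succ 0 : Fin (0 + 3)) = 1 := rfl
    have e2 : (Fin.succ 1 : Fin (0 + 3)) = 2 := rfl
    have e3 : (Fin.castSucc 0 : Fin (0 + 3)) = 0 := rfl
    have e4 : (Fin.castSucc 1 : Fin (0 + 3)) = 1 := rfl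
    have hmem : h ∈ pathSet p x y 0 z w ↔ h 0 = x ∧ h 1 = y ∧ h 2 = w ∧
        (y = z ∧ ¬ (x = z + 1 ∧ w = z + 1 ∧ Even z)) := by
      simp only [pathSet, Set.mem_ofPred_eq, IsABFPath, IsValleyRestricted, IsValley]
      rw [Fin.forall_fin_two, hone, hone]
      simp only [h1, h2, h3, h4, e1, e2, e3, e4]
      constructor
      · rintro ⟨-, -, rfl, rfl, rfl, rfl, h⟩
        exact ⟨rfl, rfl, rfl, rfl, fun h' => h ⟨by omega, h'.2.1⟩ h'.2.2⟩
      · rintro ⟨rfl, rfl, rfl, rfl, h⟩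
        exact ⟨⟨by rwa [abs_sub_comm], hw⟩, hz, rfl, rfl, rfl, rfl,
          fun h' h'' => h ⟨by omega, h'.2, h''⟩⟩
    rw [hmem]
    split_ifs with hc
    · rw [Set.mem_singleton_iff]
      constructor
      · rintro ⟨rfl, rfl, rfl, -⟩
        funext i
        fin_cases i <;> rfl
      · rintro rfl
        exact ⟨rfl, rfl, rfl, hc⟩
    · exact iff_of_false (fun h' => hc h'.2.2.2) (Set.notMem_empty _)
  rw [pathGF, hset]
  split_ifs
  · rw [finsum_mem_singleton]
    simp [pathWeight, qPow_zero]
  · exact finsum_mem_empty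

theorem pathGF_eq_stateSum {p : ℕ} (e : Bool) (c : ℤ) (L : ℕ) : ∀ (d : Bool) (k : ℤ),
    pathGF p (if e then c else c + 1) (if e then c + 1 else c) L
        (if d then k else k + 1) (if d then k + 1 else k) =
      stateSum p e c (L + 1) d k (fun _ => 1) := by
  induction L with
  | zero =>
    intro d k
    cases d
    · simp only [Bool.false_eq_true, if_false]
      by_cases hk : 0 ≤ k ∧ k < (p : ℤ)
      · rw [pathGF_zero (by omega) (by cases e <;> simp) (by simp), stateSum_down _ hk]
        cases e <;> simp [stateSum_zero, qPow_zero] <;> grind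
      · rw [stateSum_down_of_not _ hk, pathGF, pathSet_succ_eq_empty (by omega), finsum_mem_empty]
    · simp only [if_true]
      by_cases hk : 1 ≤ k ∧ k ≤ (p : ℤ)
      · rw [pathGF_zero (by omega) (by cases e <;> simp) (by simp), stateSum_up _ hk]
        cases e <;> simp [stateSum_zero, qPow_zero] <;> grind
      · rw [stateSum_up_of_not _ hk, pathGF, pathSet_succ_eq_empty (by omega), finsum_mem_empty]
  | succ L ih =>
    generalize (if e then c else c + 1) = x at ih ⊢
    generalize (if e then c + 1 else c) = y at ih ⊢
    intro d k
    cases d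
    · have h1 := ih false (k + 1)
      have h2 := ih true k
      simp only [Bool.false_eq_true, if_false, if_true] at h1 h2 ⊢
      by_cases hk : 0 ≤ k ∧ k < (p : ℤ)
      · rw [pathGF_succ (by omega) (by simp), stateSum_down _ hk, if_neg (by omega), h2, ← h1]
        congr 3
        ring
      · rw [stateSum_down_of_not _ hk, pathGF, pathSet_succ_eq_empty (by omega), finsum_mem_empty]
    · have h1 := ih true (k - 1)
      have h2 := ih false k
      simp only [Bool.false_eq_true, if_false, if_true, sub_add_cancel] at h1 h2 ⊢
      by_cases hk : 1 ≤ k ∧ k ≤ (p : ℤ)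
      · rw [pathGF_succ (by omega) (by simp), stateSum_up _ hk, h2, ← h1]
        simp only [true_and]
        congr 3
        ring
      · rw [stateSum_up_of_not _ hk, pathGF, pathSet_succ_eq_empty (by omega), finsum_mem_empty]

/-! ### Splitting off the first component of `n`. -/

section
variable {P : ℕ}

/-- Prepend a component to `(n_1, …, n_{P-1})`. -/
def consN (a : ℕ) (n : Fin (P - 1) → ℕ) : Fin (P + 1 - 1) → ℕ :=
  fun i => if h : i.val = 0 then a else n ⟨i.val - 1, by omega⟩

/-- Drop the first component of `(n_1, …, n_P)`. -/
def tailN (n : Fin (P + 1 - 1) → ℕ) : Fin (P - 1) → ℕ := fun i => n ⟨i.val + 1, by omega⟩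

theorem comp_consN_one (hP : 1 ≤ P) (a : ℕ) (n : Fin (P - 1) → ℕ) : comp (consN a n) 1 = a := by
  rw [comp, dif_pos (by omega), consN, dif_pos rfl]

theorem comp_consN_succ {k : ℕ} (hk : 1 ≤ k) (a : ℕ) (n : Fin (P - 1) → ℕ) :
    comp (consN a n) (k + 1) = comp n k := by
  rw [comp, comp]
  split_ifs with h1 h2 h2
  · rw [consN, dif_neg (by simp; omega)]
    rfl
  · omega
  · omega
  · rfl

theorem consN_tailN (hP : 1 ≤ P) (n : Fin (P + 1 - 1) → ℕ) : consN (comp n 1) (tailN n) = n := by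
  funext i
  rw [consN]
  split_ifs with h
  · rw [comp, dif_pos (by omega)]
    congr 1
    ext
    simp [h]
  · rw [tailN]
    congr 1
    ext
    simp only
    omega

theorem mVal_eq_sum_range {p : ℕ} (Δ : ℕ → ℤ) (n : Fin (p - 1) → ℕ) (i : ℕ) :
    mVal Δ n i = 2 * ∑ k ∈ Finset.range p, pPart ((k : ℤ) - i) * comp n k - Δ i := by
  rw [mVal]
  congr 2
  refine Finset.sum_subset_zero_on_sdiff (fun k hk => ?_) (fun k hk => ?_) (fun k hk => ?_)
  · rw [Finset.mem_Ioo] at hk; exact Finset.mem_range.2 hk.2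
  · rw [Finset.mem_sdiff, Finset.mem_Ioo, Finset.mem_range] at hk
    rw [pPart, max_eq_right (by omega), zero_mul]
  · rw [Finset.mem_Ioo] at hk
    rw [pPart, max_eq_left (by omega)]

/-- As a function of `i`, `|k - i|₊` has second difference concentrated at `k = i + 1`. -/
theorem mVal_second_difference {p : ℕ} (Δ : ℕ → ℤ) (n : Fin (p - 1) → ℕ) {i : ℕ}
    (hi : i + 1 < p) :
    mVal Δ n i - 2 * mVal Δ n (i + 1) + mVal Δ n (i + 2) =
      2 * comp n (i + 1) - (Δ i - 2 * Δ (i + 1) + Δ (i + 2)) := by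
  have h : ∑ k ∈ Finset.range p, pPart ((k : ℤ) - i) * comp n k -
      2 * ∑ k ∈ Finset.range p, pPart ((k : ℤ) - (i + 1 : ℕ)) * comp n k +
      ∑ k ∈ Finset.range p, pPart ((k : ℤ) - (i + 2 : ℕ)) * comp n k = comp n (i + 1) := by
    rw [Finset.mul_sum, ← Finset.sum_sub_distrib, ← Finset.sum_add_distrib,
      Finset.sum_eq_single (i + 1)]
    · simp [pPart]
    · intro k _ hk
      have : pPart ((k : ℤ) - i) - 2 * pPart ((k : ℤ) - (i + 1 : ℕ)) +
          pPart ((k : ℤ) - (i + 2 : ℕ)) = 0 := by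
        simp only [pPart]
        push_cast
        omega
      linear_combination (comp n k : ℤ) * this
    · intro h; exact absurd (Finset.mem_range.2 hi) h
  simp only [mVal_eq_sum_range]
  linear_combination 2 * h

theorem mVal_last {p : ℕ} (hp : 1 ≤ p) {Δ : ℕ → ℤ} (hΔ : Δ (p - 1) = 0) (n : Fin (p - 1) → ℕ) :
    mVal Δ n (p - 1) = 0 := by
  rw [mVal, hΔ, Finset.sum_eq_zero]
  · simp
  · intro k hk
    rw [Finset.mem_Ioo] at hk
    omega

theorem mVal_consN_succ (Δ : ℕ → ℤ) (a : ℕ) (n : Fin (P - 1) → ℕ) (i : ℕ) :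
    mVal Δ (consN a n) (i + 1) = mVal (fun i => Δ (i + 1)) n i := by
  rw [mVal_eq_sum_range, mVal_eq_sum_range, Finset.sum_range_succ']
  have h0 : pPart (((0 : ℕ) : ℤ) - (i + 1 : ℕ)) = 0 := by
    rw [pPart, max_eq_right]; push_cast; omega
  rw [h0, zero_mul, add_zero]
  congr 2
  refine Finset.sum_congr rfl fun k _ => ?_
  rcases Nat.eq_zero_or_pos k with rfl | hk
  · have h1 : pPart (((0 : ℕ) : ℤ) - i) = 0 := by
      rw [pPart, max_eq_right]; push_cast; omega
    have h2 : pPart (((0 + 1 : ℕ) : ℤ) - (i + 1 : ℕ)) = 0 := by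
      rw [pPart, max_eq_right]; push_cast; omega
    rw [h1, h2, zero_mul, zero_mul]
  · rw [comp_consN_succ hk]
    congr 2
    push_cast
    ring

end

theorem prod_Icc_one_succ (f : ℕ → QField) (N : ℕ) :
    ∏ i ∈ Finset.Icc 1 (N + 1), f i = f 1 * ∏ i ∈ Finset.Icc 1 N, f (i + 1) := by
  induction N with
  | zero => simp
  | succ N ih =>
    rw [Finset.prod_Icc_succ_top (by omega), ih, Finset.prod_Icc_succ_top (by omega), mul_assoc]

theorem sum_Icc_one_succ (f : ℕ → ℤ) (N : ℕ) :
    ∑ i ∈ Finset.Icc 1 (N + 1), f i = f 1 + ∑ i ∈ Finset.Icc 1 N, f (i + 1) := by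
  induction N with
  | zero => simp
  | succ N ih =>
    rw [Finset.sum_Icc_succ_top (by omega), ih, Finset.sum_Icc_succ_top (by omega), add_assoc]

-- Separate the first row and column of the Cartan matrix. The hypothesis disposes of `m 1` when `N
-- = 0`.
open Matrix in
theorem cartanForm_succ (m : ℕ → ℤ) (N : ℕ) (hm : m (N + 1) = 0) :
    (fun i : Fin (N + 1) => m i) ⬝ᵥ (CartanMatrix.A (N + 1)).mulVec (fun i => m i) =
      2 * m 0 ^ 2 - 2 * m 0 * m 1 +
        (fun i : Fin N => m (i + 1)) ⬝ᵥ (CartanMatrix.A N).mulVec (fun i => m (i + 1)) := by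
  have hss : ∀ i j : Fin N, CartanMatrix.A (N + 1) i.succ j.succ = CartanMatrix.A N i j := by
    intro i j
    simp [CartanMatrix.A]
  have h00 : CartanMatrix.A (N + 1) 0 0 = 2 := by simp [CartanMatrix.A]
  have hsymm : ∀ j : Fin N,
      CartanMatrix.A (N + 1) j.succ 0 = CartanMatrix.A (N + 1) 0 j.succ := by
    intro j
    simp [CartanMatrix.A, or_comm, Fin.ext_iff]
  have hrow : ∑ j : Fin N, CartanMatrix.A (N + 1) 0 j.succ * m (j + 1) = - m 1 := by
    rcases N with _ | N
    · simp at hm ⊢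
      exact hm
    · rw [Fin.sum_univ_succ, Finset.sum_eq_zero]
      · simp [CartanMatrix.A, Fin.ext_iff]
      · intro j _
        simp [CartanMatrix.A, Fin.ext_iff]
  simp only [dotProduct, mulVec, Fin.sum_univ_succ, hss, h00, Fin.val_zero, Fin.val_succ, hsymm,
    mul_add, Finset.sum_add_distrib]
  have h2 : ∑ j : Fin N, m (j + 1) * (CartanMatrix.A (N + 1) 0 j.succ * m 0) = - m 1 * m 0 := by
    rw [← hrow, Finset.sum_mul]
    exact Finset.sum_congr rfl fun j _ => by ring
  rw [hrow, h2]
  ring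

section
variable {P : ℕ}

theorem quadForm_consN (hP : 2 ≤ P) {Δ : ℕ → ℤ} (hΔ : Δ P = 0) (a : ℕ) (n : Fin (P - 1) → ℕ) :
    quadForm Δ (consN a n) =
      2 * mVal (fun i => Δ (i + 1)) n 0 ^ 2 -
        2 * mVal (fun i => Δ (i + 1)) n 0 * mVal (fun i => Δ (i + 1)) n 1 +
          quadForm (fun i => Δ (i + 1)) n := by
  obtain ⟨N, rfl⟩ : ∃ N, P = N + 2 := ⟨P - 2, by omega⟩
  have := cartanForm_succ (mVal (fun i => Δ (i + 1)) n) N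
    (mVal_last (p := N + 2) (by omega) hΔ n)
  simp only [quadForm, mVal_consN_succ]
  exact this

/-- Given the tail, `n_1` enters only the first binomial and `n · T^R`. If `l = 1`, all of `-m_ℓ/2`
is split off, and the new position `P - 1` adds nothing because the last `m` vanishes. -/
theorem fermionicTerm_consN (hP : 2 ≤ P) {l : ℕ} (hl : 1 ≤ l) {Δ : ℕ → ℤ} (hΔ : Δ P = 0)
    (TL TR : ℕ → ℤ) (a : ℕ) (n : Fin (P - 1) → ℕ) {M K : ℤ}
    (hM : mVal (fun i => Δ (i + 1)) n 0 = M) (hK : mVal (fun i => Δ (i + 1)) n 1 = K) :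
    fermionicTerm (P + 1) l Δ TL TR (consN a n) =
      qPow ((M * (M - K) : ℤ) / 2 - (if l = 1 then (M : ℚ) / 2 else 0) + (a * TR 1 : ℤ)) *
        qBinomMod (qPow 2) a ((M - TL 1 - TR 1) / 2) *
      fermionicTerm P (if l = 1 then P - 1 else l - 1) (fun i => Δ (i + 1)) (fun i => TL (i + 1))
        (fun i => TR (i + 1)) n := by
  have h1 : mVal Δ (consN a n) l = (if l = 1 then M else 0) +
      mVal (fun i => Δ (i + 1)) n (if l = 1 then P - 1 else l - 1) := by
    obtain ⟨l, rfl⟩ : ∃ k, l = k + 1 := ⟨l - 1, by omega⟩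
    rw [mVal_consN_succ]
    by_cases h : l = 0
    · subst h
      simp only [zero_add, if_true]
      rw [mVal_last (by omega) (by simpa [Nat.sub_add_cancel (show 1 ≤ P by omega)] using hΔ), hM,
        add_zero]
    · simp [h]
  have h2 : ∑ i ∈ Finset.Icc 1 (P + 1 - 1), (comp (consN a n) i : ℤ) * TR i =
      a * TR 1 + ∑ i ∈ Finset.Icc 1 (P - 1), (comp n i : ℤ) * TR (i + 1) := by
    rw [show P + 1 - 1 = P - 1 + 1 by omega, sum_Icc_one_succ, comp_consN_one (by omega)]
    congr 1
    refine Finset.sum_congr rfl fun i hi => ?_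
    rw [comp_consN_succ (Finset.mem_Icc.1 hi).1]
  have h3 : ∏ i ∈ Finset.Icc 1 (P + 1 - 2),
      qBinomMod (qPow 2) (comp (consN a n) i) (mHat Δ TL TR (consN a n) i) =
      qBinomMod (qPow 2) a ((M - TL 1 - TR 1) / 2) * ∏ i ∈ Finset.Icc 1 (P - 2),
        qBinomMod (qPow 2) (comp n i) (mHat (fun i => Δ (i + 1)) (fun i => TL (i + 1))
          (fun i => TR (i + 1)) n i) := by
    rw [show P + 1 - 2 = P - 2 + 1 by omega, prod_Icc_one_succ, comp_consN_one (by omega), mHat,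
      (mVal_consN_succ Δ a n 0).trans hM]
    congr 1
    refine Finset.prod_congr rfl fun i hi => ?_
    rw [comp_consN_succ (Finset.mem_Icc.1 hi).1, mHat, mVal_consN_succ, mHat]
  rw [fermionicTerm, h1, h2, h3, quadForm_consN hP hΔ, hM, hK, fermionicTerm]
  rw [mul_mul_mul_comm, qPow_mul_qPow]
  congr 2
  push_cast
  split_ifs <;> ring

end

/-! ### Finiteness of the index set and the sign of `m_1`. -/

theorem fermionicIndex_finite (p L : ℕ) (Δ : ℕ → ℤ) : (fermionicIndex p L Δ).Finite := by
  refine (Set.finite_Iic (fun _ : Fin (p - 1) => ((L : ℤ) + Δ 0).toNat)).subset ?_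
  intro n hn
  rw [fermionicIndex, Set.mem_ofPred_eq, mVal_eq_sum_range] at hn
  refine Set.mem_Iic.2 fun i => ?_
  show n i ≤ ((L : ℤ) + Δ 0).toNat
  have h1 : pPart (((i.val + 1 : ℕ) : ℤ) - (0 : ℕ)) * comp n (i.val + 1) ≤
      ∑ k ∈ Finset.range p, pPart ((k : ℤ) - (0 : ℕ)) * comp n k :=
    Finset.single_le_sum (f := fun k : ℕ => pPart ((k : ℤ) - (0 : ℕ)) * (comp n k : ℤ))
      (fun k _ => mul_nonneg (le_max_right _ _) (by positivity)) (Finset.mem_range.2 (by omega))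
  have h2 : comp n (i.val + 1) = n i := by
    rw [comp, dif_pos (by omega)]
    rfl
  have h3 : (1 : ℤ) ≤ pPart (((i.val + 1 : ℕ) : ℤ) - (0 : ℕ)) := by
    rw [pPart]; push_cast; omega
  rw [h2] at h1
  have h4 : (n i : ℤ) ≤ pPart (((i.val + 1 : ℕ) : ℤ) - (0 : ℕ)) * n i :=
    le_mul_of_one_le_left (by positivity) h3
  omega

/-- In a nonvanishing fermionic term with `m_0 ≥ 0` also `m_1 ≥ 0`. -/
theorem mVal_one_nonneg {p : ℕ} (hp : 2 ≤ p) {l : ℕ} {Δ TL TR : ℕ → ℤ} (hΔ : Δ (p - 1) = 0)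
    (hconv : ∀ i, i + 2 < p → 0 ≤ Δ i - 2 * Δ (i + 1) + Δ (i + 2))
    (hTL : ∀ i, 1 ≤ i → i < p → 0 ≤ TL i) (hTR : ∀ i, 1 ≤ i → i < p → 0 ≤ TR i)
    {n : Fin (p - 1) → ℕ}
    (h0 : 0 ≤ mVal Δ n 0) (h : fermionicTerm p l Δ TL TR n ≠ 0) : 0 ≤ mVal Δ n 1 := by
  by_contra! h1
  -- Once `m` is negative, `m̂ < 0` forces `n_i = 0`; then `m` is concave and keeps decreasing,
  -- contradicting `m_{p-1} = 0`.
  have key : ∀ i, i + 1 ≤ p - 1 → mVal Δ n (i + 1) < 0 ∧ mVal Δ n (i + 1) < mVal Δ n i := by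
    intro i
    induction i with
    | zero => exact fun _ => ⟨h1, by simpa using by omega⟩
    | succ i ih =>
      intro hi
      obtain ⟨h2, h3⟩ := ih (by omega)
      have h4 : qBinomMod (qPow 2) (comp n (i + 1)) (mHat Δ TL TR n (i + 1)) ≠ 0 :=
        Finset.prod_ne_zero_iff.1 (right_ne_zero_of_mul h) _ (Finset.mem_Icc.2 (by omega))
      have h5 : mHat Δ TL TR n (i + 1) < 0 := by
        rw [mHat]
        have := hTL (i + 1) (by omega) (by omega)
        have := hTR (i + 1) (by omega) (by omega)
        omega
      have h6 : (comp n (i + 1) : ℤ) = 0 := by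
        by_contra h7
        exact h4 (qBinomMod_of_pos_of_neg _ h7 h5)
      have h7 := mVal_second_difference Δ n (i := i) (by omega)
      have h8 := hconv i (by omega)
      rw [show i + 1 + 1 = i + 2 from rfl]
      omega
  have h2 := (key (p - 2) (by omega)).1
  rw [show p - 2 + 1 = p - 1 by omega, mVal_last (by omega) hΔ] at h2
  exact lt_irrefl _ h2

/-! ### Parities and inhomogeneities under contraction. -/

/-- The parity attached to the `i`-th contraction of an initial edge `(e, edgeL p e l)`. -/
def statePar (p : ℕ) (e : Bool) (l i : ℕ) : ℤ :=
  (if e then pPart ((l : ℤ) - i) else (p : ℤ) - 1 - l + pPart ((i : ℤ) - l)) % 2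

/-- The inhomogeneity `Δ_i` attached to the initial edge `(e, edgeL p e l)` and the final edge
`(d, edgeR p d r)`. -/
def stateDelta (p : ℕ) (e d : Bool) (l r i : ℕ) : ℤ :=
  pPart ((l : ℤ) - i) + pPart ((r : ℤ) - i) + if e = d then (p : ℤ) - 1 - i else 0

/-- The position of the contracted edge. -/
def nextPosN (P l : ℕ) : ℕ := if l = 1 then P - 1 else l - 1

theorem nextPosN_cast {P l : ℕ} (hP : 2 ≤ P) (hl : 1 ≤ l) : (nextPosN P l : ℤ) = nextPos P l := by
  simp only [nextPosN, nextPos]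
  split_ifs <;> omega

theorem statePar_succ {P l i : ℕ} (hP : 2 ≤ P) (hl : 1 ≤ l ∧ l ≤ P) (hi : 1 ≤ i ∧ i < P)
    (e : Bool) :
    statePar (P + 1) e l (i + 1) = statePar P (nextDir e l) (nextPosN P l) i := by
  by_cases h : l = 1 <;> cases e <;> simp [statePar, nextDir, nextPosN, h, pPart] <;> omega

theorem statePar_one {P l : ℕ} (hl : 1 ≤ l ∧ l ≤ P) (e : Bool) :
    statePar (P + 1) e l 1 = (edgeL ((P : ℤ) + 1) e l - 1) % 2 := by
  cases e <;> simp [statePar, edgeL, pPart] <;> omega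

theorem statePar_not_one {P r : ℕ} (hr : 1 ≤ r ∧ r ≤ P) (d : Bool) :
    statePar (P + 1) (!d) r 1 = (edgeR ((P : ℤ) + 1) d r - 1) % 2 := by
  cases d <;> simp [statePar, edgeR, pPart] <;> omega

theorem nextDir_not (d : Bool) (r : ℤ) : nextDir (!d) r = !nextDir d r := by
  simp only [nextDir]; split_ifs <;> rfl

/-- A reflection creates a summand `P - 1 - i` and toggles the one for `e = d`, so the discrepancy
is an even multiple of `P - 1 - i`. -/
theorem stateDelta_succ {P l r : ℕ} (hP : 2 ≤ P) (hl : 1 ≤ l ∧ l ≤ P) (hr : 1 ≤ r ∧ r ≤ P)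
    (e d : Bool) : ∃ κ : ℤ, ∀ i < P, stateDelta (P + 1) e d l r (i + 1) =
      stateDelta P (nextDir e l) (nextDir d r) (nextPosN P l) (nextPosN P r) i +
        2 * κ * ((P : ℤ) - 1 - i) := by
  by_cases h : l = 1 <;> by_cases h' : r = 1
  · refine ⟨-1, fun i hi => ?_⟩
    cases e <;> cases d <;> simp [stateDelta, nextDir, nextPosN, h, h', pPart] <;> omega
  · refine ⟨if e = d then 0 else -1, fun i hi => ?_⟩
    cases e <;> cases d <;> simp [stateDelta, nextDir, nextPosN, h, h', pPart] <;> omega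
  · refine ⟨if e = d then 0 else -1, fun i hi => ?_⟩
    cases e <;> cases d <;> simp [stateDelta, nextDir, nextPosN, h, h', pPart] <;> omega
  · refine ⟨0, fun i _ => ?_⟩
    cases e <;> cases d <;> simp [stateDelta, nextDir, nextPosN, h, h', pPart] <;> omega

/-! ### The induction on the height of the strip. -/

/-- Between heights `1` and `2` a path can only alternate: it has no straight vertex, and its
valleys have odd height. -/
theorem stateSum_two {e : Bool} (j : ℕ) : ∀ (d : Bool) (φ : ℤ → QField),
    stateSum 2 e 1 j d 1 φ = if (e = d ↔ Even j) then φ 0 else 0 := by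
  induction j with
  | zero => intro d φ; simp [stateSum_zero]
  | succ j ih =>
    intro d φ
    cases d
    · rw [stateSum_down j (by omega), stateSum_down_eq_zero (k := 1 + 1) (by omega) (by omega),
        ih]
      cases e <;> simp [Nat.even_add_one]
    · rw [stateSum_up j (by omega), stateSum_up_eq_zero (k := 1 - 1) (by omega) (by omega), ih]
      cases e <;> simp [Nat.even_add_one]

/-- The only candidate is `n_1 = (L + Δ_0)/2`, which `h0` makes nonnegative; its term is `1`. -/
theorem fermionic_two {e d : Bool} {Δ TL TR : ℕ → ℤ} {κ : ℤ}
    (hΔ : ∀ i < 2, Δ i = stateDelta 2 e d 1 1 i + 2 * κ * ((2 : ℤ) - 1 - i)) (h0 : 0 ≤ Δ 0)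
    (hTR : TR 1 = 0) (L : ℕ) (φ : ℤ → QField) :
    stateSum 2 e 1 (L + 1) d 1 φ =
      ∑ᶠ n ∈ fermionicIndex 2 L Δ, φ (mVal Δ n 1) * fermionicTerm 2 1 Δ TL TR n := by
  have hm1 : ∀ n : Fin (2 - 1) → ℕ, mVal Δ n 1 = 0 := fun n =>
    mVal_last (p := 2) (by omega) (by rw [hΔ _ (by omega)]; simp [stateDelta, pPart]) n
  have hterm : ∀ n : Fin (2 - 1) → ℕ, fermionicTerm 2 1 Δ TL TR n = 1 := fun n => by
    simp [fermionicTerm, hm1, hTR, quadForm, qPow_zero]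
  have hm0 : ∀ n : Fin (2 - 1) → ℕ, mVal Δ n 0 = 2 * n 0 - Δ 0 := fun n => by
    rw [mVal_eq_sum_range]
    simp [Finset.sum_range_succ, pPart, comp]
  have hΔ0 : Δ 0 = 2 + (if e = d then 1 else 0) + 2 * κ := by
    rw [hΔ 0 (by omega)]
    simp [stateDelta, pPart]
  have hset : fermionicIndex 2 L Δ =
      if (e = d ↔ Even (L + 1)) then {fun _ => ((L + Δ 0) / 2).toNat} else ∅ := by
    ext n
    rw [fermionicIndex, Set.mem_ofPred_eq, hm0]
    split_ifs with h
    · rw [Set.mem_singleton_iff]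
      have h2 : Even (L + Δ 0) := by
        rw [hΔ0]
        by_cases hed : e = d
        · have := h.1 hed
          simp [hed, parity_simps] at this ⊢
          grind
        · have : ¬ Even (L + 1) := fun h' => hed (h.2 h')
          simp [hed, parity_simps] at this ⊢
          exact this
      obtain ⟨c, hc⟩ := h2
      constructor
      · intro h3
        funext i
        obtain rfl : i = 0 := Fin.ext (by omega)
        omega
      · rintro rfl
        show 2 * ((((L : ℤ) + Δ 0) / 2).toNat : ℤ) - Δ 0 = L
        omega
    · refine iff_of_false (fun h2 => h ?_) (Set.notMem_empty _)
      rw [hΔ0] at h2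
      by_cases hed : e = d
      · simp only [hed, true_iff, if_true] at h2 ⊢
        rw [Nat.even_iff]
        omega
      · simp only [hed, false_iff, if_false] at h2 ⊢
        rw [Nat.even_iff]
        omega
  rw [stateSum_two, hset]
  split_ifs
  · rw [finsum_mem_singleton, hm1, hterm, mul_one]
  · rw [finsum_mem_empty]

theorem statePar_nonneg (p : ℕ) (e : Bool) (l i : ℕ) : 0 ≤ statePar p e l i :=
  Int.emod_nonneg _ two_ne_zero

theorem stateDelta_second_difference {p l r i : ℕ} {e d : Bool} {κ : ℤ} {Δ : ℕ → ℤ}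
    (hΔ : ∀ i < p, Δ i = stateDelta p e d l r i + 2 * κ * ((p : ℤ) - 1 - i)) (hi : i + 2 < p) :
    Δ i - 2 * Δ (i + 1) + Δ (i + 2) =
      (if l = i + 1 then 1 else 0) + (if r = i + 1 then 1 else 0) := by
  have h1 : ∀ l : ℕ, pPart ((l : ℤ) - i) - 2 * pPart ((l : ℤ) - (i + 1 : ℕ)) +
      pPart ((l : ℤ) - (i + 2 : ℕ)) = if l = i + 1 then 1 else 0 := by
    intro l
    simp only [pPart]
    push_cast
    split_ifs <;> omega
  rw [hΔ i (by omega), hΔ (i + 1) (by omega), hΔ (i + 2) (by omega), ← h1 l, ← h1 r]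
  simp only [stateDelta]
  push_cast
  split_ifs <;> ring

theorem stateDelta_last {p l r : ℕ} (hp : 1 ≤ p) (hl : l < p) (hr : r < p) (e d : Bool) :
    stateDelta p e d l r (p - 1) = 0 := by
  simp only [stateDelta, pPart]
  split_ifs <;> omega

/-- The fermionic form of the path sums, refined by the number of straight vertices. -/
theorem stateSum_eq_fermionic {p : ℕ} (hp : 2 ≤ p) : ∀ (e d : Bool) (l r : ℕ),
    1 ≤ l ∧ l < p → 1 ≤ r ∧ r < p → ∀ (Δ TL TR : ℕ → ℤ) (κ : ℤ),
    (∀ i < p, Δ i = stateDelta p e d l r i + 2 * κ * ((p : ℤ) - 1 - i)) → 0 ≤ Δ (p - 2) →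
    (∀ i, 1 ≤ i → i < p → TL i = statePar p e l i) →
    (∀ i, 1 ≤ i → i < p → TR i = statePar p (!d) r i) → ∀ (L : ℕ) (φ : ℤ → QField),
    stateSum p e (edgeL p e l) (L + 1) d (edgeR p d r) φ =
      ∑ᶠ n ∈ fermionicIndex p L Δ, φ (mVal Δ n 1) * fermionicTerm p l Δ TL TR n := by
  -- `Δ` matters only up to `2κ(p - 1 - i)`, which a shift of `n_{p-1}` by `κ` absorbs: this
  -- component has no binomial and `T^R_{p-1} = 0`. The bound `0 ≤ Δ (p - 2)` keeps `n_{p-1} =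
  -- (m_{p-2} + Δ_{p-2})/2` nonnegative when `m_{p-2} ≥ 0`.
  induction p, hp using Nat.le_induction with
  | base =>
    intro e d l r hl hr Δ TL TR κ hΔ h0 hTL hTR L φ
    obtain rfl : l = 1 := by omega
    obtain rfl : r = 1 := by omega
    have e1 : edgeL (2 : ℕ) e (1 : ℕ) = 1 := by cases e <;> rfl
    have e2 : edgeR (2 : ℕ) d (1 : ℕ) = 1 := by cases d <;> rfl
    rw [e1, e2]
    refine fermionic_two (κ := κ) hΔ h0 ?_ L φ
    rw [hTR 1 le_rfl (by omega)]
    cases d <;> rfl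
  | succ P hP ih =>
    intro e d l r hl hr Δ TL TR κ hΔ h0 hTL hTR L φ
    have hP1 : ((P + 1 : ℕ) : ℤ) = (P : ℤ) + 1 := by push_cast; rfl
    have hlast : Δ P = 0 := by
      rw [hΔ P (by omega)]
      have := stateDelta_last (p := P + 1) (by omega) hl.2 hr.2 e d
      rw [Nat.add_sub_cancel] at this
      rw [this]
      push_cast
      ring
    have hdd := stateDelta_second_difference (i := 0) hΔ (by omega)
    have hpos : ∀ n : Fin (P + 1 - 1) → ℕ, n ∈ fermionicIndex (P + 1) L Δ →
        fermionicTerm (P + 1) l Δ TL TR n ≠ 0 → 0 ≤ mVal Δ n 1 := by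
      intro n hn hne
      rw [fermionicIndex, Set.mem_ofPred_eq] at hn
      refine mVal_one_nonneg (by omega) hlast (fun i hi => ?_) (fun i h1 h2 => ?_)
        (fun i h1 h2 => ?_) (by omega) hne
      · rw [stateDelta_second_difference hΔ hi]
        positivity
      · rw [hTL i h1 h2]; exact statePar_nonneg _ _ _ _
      · rw [hTR i h1 h2]; exact statePar_nonneg _ _ _ _
    obtain ⟨κ', hκ'⟩ := stateDelta_succ hP (l := l) (r := r) (by omega) (by omega) e d
    have hnl : 1 ≤ nextPosN P l ∧ nextPosN P l < P := by rw [nextPosN]; split_ifs <;> omega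
    have hnr : 1 ≤ nextPosN P r ∧ nextPosN P r < P := by rw [nextPosN]; split_ifs <;> omega
    have hstep : ∀ M : ℕ, stateSum (P + 1 : ℕ) e (edgeL (P + 1 : ℕ) e l) (L + 1) d
        (edgeR (P + 1 : ℕ) d r) (fun K => if K = M then 1 else 0) =
        ∑ᶠ n ∈ fermionicIndex P M (fun i => Δ (i + 1)),
          (qPow (if r = 1 then M / 2 else 0) * stepCoeff (TL 1) (TR 1) L M
            (mVal (fun i => Δ (i + 1)) n 1 + (if l = 1 then 1 else 0) + (if r = 1 then 1 else 0))) *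
          fermionicTerm P (nextPosN P l) (fun i => Δ (i + 1)) (fun i => TL (i + 1))
            (fun i => TR (i + 1)) n := by
      intro M
      rw [hP1, stateSum_step (by omega) (by omega) (by omega), ← nextPosN_cast hP hl.1,
        ← nextPosN_cast hP hr.1, ← statePar_one (by omega), ← statePar_not_one (by omega),
        ← hTL 1 le_rfl (by omega), ← hTR 1 le_rfl (by omega),
        ih (nextDir e l) (nextDir d r) _ _ hnl hnr (fun i => Δ (i + 1)) (fun i => TL (i + 1))
          (fun i => TR (i + 1)) (κ + κ')]
      · simp only [Nat.cast_eq_one]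
      · intro i hi
        rw [hΔ (i + 1) (by omega), hκ' i hi]
        push_cast
        ring
      · simpa only [show P + 1 - 2 = P - 2 + 1 by omega] using h0
      · intro i h1 h2
        rw [hTL (i + 1) (by omega) (by omega), statePar_succ hP (by omega) ⟨h1, h2⟩]
      · intro i h1 h2
        rw [hTR (i + 1) (by omega) (by omega), statePar_succ hP (by omega) ⟨h1, h2⟩, nextDir_not]
    have hfin := fermionicIndex_finite (P + 1) L Δ
    obtain ⟨B, hB1, hB2⟩ : ∃ B : ℕ, L + 1 < B ∧ ∀ n ∈ hfin.toFinset, (mVal Δ n 1).toNat < B := by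
      refine ⟨L + 2 + hfin.toFinset.sup fun n => (mVal Δ n 1).toNat, by omega, fun n hn => ?_⟩
      have := Finset.le_sup (f := fun n => (mVal Δ n 1).toNat) hn
      omega
    have hfin' : ∀ M : ℕ, (fermionicIndex P M (fun i => Δ (i + 1))).Finite := fun M =>
      fermionicIndex_finite P M _
    have hstep' := fun M => (hstep M).trans (finsum_mem_eq_finite_toFinset_sum _ (hfin' M))
    rw [stateSum_expand _ _ _ φ hB1, finsum_mem_eq_finite_toFinset_sum _ hfin]
    simp only [hstep', Finset.mul_sum]
    rw [Finset.sum_sigma']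
    have hm1 : ∀ n : Fin (P + 1 - 1) → ℕ,
        mVal Δ n 1 = mVal (fun i => Δ (i + 1)) (tailN n) 0 := by
      intro n
      conv_lhs => rw [← consN_tailN (by omega) n]
      exact mVal_consN_succ Δ _ _ 0
    have hm0 : ∀ n : Fin (P + 1 - 1) → ℕ, mVal Δ n 0 = 2 * comp n 1 +
        2 * mVal (fun i => Δ (i + 1)) (tailN n) 0 - mVal (fun i => Δ (i + 1)) (tailN n) 1 -
          ((if l = 1 then 1 else 0) + (if r = 1 then 1 else 0)) := by
      intro n
      have h1 := mVal_second_difference Δ n (i := 0) (by omega)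
      have h3 : mVal Δ n 2 = mVal (fun i => Δ (i + 1)) (tailN n) 1 := by
        conv_lhs => rw [← consN_tailN (by omega) n]
        exact mVal_consN_succ Δ _ _ 1
      simp only [zero_add] at h1 hdd
      rw [hdd, hm1, h3] at h1
      linear_combination h1
    have hterm : ∀ n : Fin (P + 1 - 1) → ℕ, n ∈ fermionicIndex (P + 1) L Δ → ∀ M : ℕ,
        mVal (fun i => Δ (i + 1)) (tailN n) 0 = M →
        fermionicTerm (P + 1) l Δ TL TR n =
          (qPow (if r = 1 then M / 2 else 0) * stepCoeff (TL 1) (TR 1) L M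
            (mVal (fun i => Δ (i + 1)) (tailN n) 1 + (if l = 1 then 1 else 0) +
              (if r = 1 then 1 else 0))) *
          fermionicTerm P (nextPosN P l) (fun i => Δ (i + 1)) (fun i => TL (i + 1))
            (fun i => TR (i + 1)) (tailN n) := by
      intro n hn M hM
      rw [fermionicIndex, Set.mem_ofPred_eq, hm0, hM] at hn
      conv_lhs => rw [← consN_tailN (by omega) n]
      rw [fermionicTerm_consN hP hl.1 hlast TL TR _ _ hM rfl,
        stepCoeff_of_eq (n := comp n 1) (by linarith), ← mul_assoc (qPow _) (qPow _), qPow_mul_qPow]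
      -- Each shift of `K` by one changes `M(M - K)/2` by `-M/2`. The right one is cancelled by the
      -- reflection factor; the left one is the part of `-m_ℓ/2` split off for `l = 1`.
      congr 3
      push_cast
      split_ifs <;> ring
    symm
    -- Match `n` with `(m_1, tail)`. Terms with `m_1 < 0`, where `toNat` is wrong, vanish by `hpos`;
    -- conversely `n_1` is recovered from `L`, `M` and the tail, and is nonnegative because the
    -- coefficient does not vanish.
    refine Finset.sum_bij_ne_zero
      (fun n _ _ => (⟨(mVal Δ n 1).toNat, tailN n⟩ : Σ _ : ℕ, Fin (P - 1) → ℕ)) ?_ ?_ ?_ ?_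
    · intro n hn hne
      rw [Finset.mem_sigma, Finset.mem_range, Set.Finite.mem_toFinset, fermionicIndex,
        Set.mem_ofPred_eq]
      refine ⟨hB2 n hn, ?_⟩
      have := hpos n (hfin.mem_toFinset.1 hn) (right_ne_zero_of_mul hne)
      rw [Int.toNat_of_nonneg this, hm1]
    · intro n hn _ n' hn' _ h
      obtain ⟨-, h2⟩ := Sigma.mk.inj_iff.1 h
      have h2 := eq_of_heq h2
      have h3 := hm0 n
      have h4 := hm0 n'
      rw [hfin.mem_toFinset, fermionicIndex, Set.mem_ofPred_eq] at hn hn'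
      rw [hn, h2] at h3
      rw [hn'] at h4
      rw [← consN_tailN (by omega) n, ← consN_tailN (by omega) n', h2]
      congr 1
      omega
    · rintro ⟨M, n⟩ hx hne
      rw [Finset.mem_sigma, Finset.mem_range, Set.Finite.mem_toFinset, fermionicIndex,
        Set.mem_ofPred_eq] at hx
      obtain ⟨hMB, hnM⟩ := hx
      simp only at hMB hnM hne
      have hc := right_ne_zero_of_mul (left_ne_zero_of_mul (right_ne_zero_of_mul hne))
      have hnn := not_lt.1 (mt stepCoeff_of_lt hc)
      obtain ⟨a, ha⟩ : Even ((L : ℤ) - 2 * M + (mVal (fun i => Δ (i + 1)) n 1 +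
          (if l = 1 then 1 else 0) + (if r = 1 then 1 else 0))) := by
        by_contra h
        exact hc (by rw [stepCoeff, if_neg h])
      have htail : tailN (consN a.toNat n) = n := by
        funext i
        simp [tailN, consN]
      have hmem : consN a.toNat n ∈ fermionicIndex (P + 1) L Δ := by
        rw [fermionicIndex, Set.mem_ofPred_eq, hm0, htail, comp_consN_one (by omega), hnM]
        omega
      have hM1 : mVal Δ (consN a.toNat n) 1 = M := by rw [hm1, htail, hnM]
      refine ⟨consN a.toNat n, hfin.mem_toFinset.2 hmem, ?_, ?_⟩
      · rw [hM1, hterm _ hmem M (by rw [htail, hnM]), htail]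
        exact hne
      · rw [hM1, htail, Int.toNat_natCast]
    · intro n hn hne
      have hn' := hfin.mem_toFinset.1 hn
      have h0 := hpos n hn' (right_ne_zero_of_mul hne)
      have h1 : ((mVal Δ n 1).toNat : ℤ) = mVal Δ n 1 := Int.toNat_of_nonneg h0
      show _ = φ ((mVal Δ n 1).toNat : ℤ) * _
      rw [← hterm n hn' (mVal Δ n 1).toNat (by rw [h1, hm1]), h1]

/-! ### The four boundary cases. -/

/-- The fermionic form of the generating functions of the valley-restricted paths. -/
theorem hasFermionicForm_of_state {p : ℕ} (hp : 2 ≤ p) {e d : Bool} {l r : ℕ}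
    (hl : 1 ≤ l ∧ l < p) (hr : 1 ≤ r ∧ r < p) {Δ TL TR : ℕ → ℤ}
    (hΔ : ∀ i < p, Δ i = stateDelta p e d l r i)
    (hTL : ∀ i, 1 ≤ i → i < p → TL i = statePar p e l i)
    (hTR : ∀ i, 1 ≤ i → i < p → TR i = statePar p (!d) r i) {L : ℕ} {G : QField}
    (hG : G = stateSum p e (edgeL p e l) (L + 1) d (edgeR p d r) (fun _ => 1)) :
    HasFermionicForm G p L l Δ TL TR := by
  refine ⟨fermionicIndex_finite p L Δ, fun n => ⟨mVal_last (by omega) ?_ n, fun i h1 h2 => ?_⟩, ?_⟩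
  · rw [hΔ _ (by omega), stateDelta_last (by omega) hl.2 hr.2]
  · have e0 : ∀ (b : Bool) (l : ℕ), statePar p b l i = 0 ∨ statePar p b l i = 1 := fun b l =>
      Int.emod_two_eq_zero_or_one _
    -- Modulo `2`, `m_i ≡ Δ_i ≡ T^L_i + T^R_i`.
    have hpar : (mVal Δ n i - TL i - TR i) % 2 = 0 := by
      rw [mVal, hΔ i (by omega), hTL i h1 (by omega), hTR i h1 (by omega)]
      generalize ∑ k ∈ Finset.Ioo i p, ((k : ℤ) - i) * comp n k = S
      cases e <;> cases d <;> simp [stateDelta, statePar, pPart] <;> omega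
    have hL := e0 e l
    have hR := e0 (!d) r
    rw [← hTL i h1 (by omega)] at hL
    rw [← hTR i h1 (by omega)] at hR
    rw [mHat]
    omega
  · rw [hG, stateSum_eq_fermionic hp e d l r hl hr Δ TL TR 0 (by simpa using hΔ) ?_ hTL hTR]
    · simp only [one_mul]
    · rw [hΔ _ (by omega)]
      simp only [stateDelta, pPart]
      split_ifs <;> omega

/-- The flags have opposite conventions: `e = 1` is an upward first edge, `f = 1` a downward last
edge. -/
theorem restrictedGF_eq_stateSum (p a b : ℕ) (e d : Bool) (L : ℕ) :
    restrictedGF p a b (if e then 1 else 0) (if d then 0 else 1) L =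
      stateSum p e (if e then (a : ℤ) - 1 else a) (L + 1) d (if d then (b : ℤ) else b - 1)
        (fun _ => 1) := by
  rw [← pathGF_eq_stateSum, restrictedGF, restrictedPaths_eq_pathSet, pathGF]
  congr! 4
  cases e <;> cases d <;> simp <;> ring_nf

end

theorem mainTheorem3 (p a b L : ℕ) (ha : 1 ≤ a) (hap : a ≤ p) (hb : 1 ≤ b) (hbp : b ≤ p)
    (hL : Even (L + a + b)) :
    -- case (a): (e, f) = (1, 1)
    (a ≠ 1 → b ≠ 1 →
      HasFermionicForm (restrictedGF p a b 1 1 L) p L (a - 1)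
        (fun i => pPart ((a : ℤ) - 1 - i) + pPart ((b : ℤ) - 1 - i))
        (parityQ a (p - 1)) (parityQ b (p - 1))) ∧
    -- case (b): (e, f) = (0, 1)
    (a ≠ p → b ≠ 1 →
      HasFermionicForm (restrictedGF p a b 0 1 L) p L (p - a)
        (fun i => pPart ((p : ℤ) - a - i) + pPart ((b : ℤ) - 1 - i) + ((p : ℤ) - 1 - i))
        (parityR a (p - 1)) (parityQ b (p - 1))) ∧
    -- case (c): (e, f) = (0, 0)
    (a ≠ p → b ≠ p →
      HasFermionicForm (restrictedGF p a b 0 0 L) p L (p - a)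
        (fun i => pPart ((p : ℤ) - a - i) + pPart ((p : ℤ) - b - i))
        (parityR a (p - 1)) (parityR b (p - 1))) ∧
    -- case (d): (e, f) = (1, 0)
    (a ≠ 1 → b ≠ p →
      HasFermionicForm (restrictedGF p a b 1 0 L) p L (a - 1)
        (fun i => pPart ((a : ℤ) - 1 - i) + pPart ((p : ℤ) - b - i) + ((p : ℤ) - 1 - i))
        (parityQ a (p - 1)) (parityR b (p - 1))) := by
  -- `Q` belongs to upward and `R` to downward initial edges. They also serve on the right, a final
  -- edge being an initial edge run backwards.
  have hQ : ∀ c : ℕ, 1 ≤ c → ∀ i, parityQ c (p - 1) i = statePar p true (c - 1) i := by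
    intro c hc i
    simp [parityQ, statePar, Nat.cast_sub hc]
  have hR : ∀ c : ℕ, c ≤ p → ∀ i, parityR c (p - 1) i = statePar p false (p - c) i := by
    intro c hc i
    simp only [parityR, statePar, pPart, Nat.cast_sub hc, Nat.cast_sub (ha.trans hap)]
    simp
    omega
  have ca : ((a - 1 : ℕ) : ℤ) = a - 1 := by omega
  have cb : ((b - 1 : ℕ) : ℤ) = b - 1 := by omega
  have da : ((p - a : ℕ) : ℤ) = p - a := by omega
  have db : ((p - b : ℕ) : ℤ) = p - b := by omega
  refine ⟨fun h1 h2 => ?_, fun h1 h2 => ?_, fun h1 h2 => ?_, fun h1 h2 => ?_⟩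
  · refine hasFermionicForm_of_state (e := true) (d := false) (r := b - 1) (by omega) (by omega)
      (by omega) (fun i _ => ?_) (fun i _ _ => hQ a ha i) (fun i _ _ => hQ b hb i) ?_
    · simp [stateDelta, ca, cb]
    · simpa [edgeL, edgeR, ca, cb] using restrictedGF_eq_stateSum p a b true false L
  · refine hasFermionicForm_of_state (e := false) (d := false) (r := b - 1) (by omega) (by omega)
      (by omega) (fun i _ => ?_) (fun i _ _ => hR a hap i) (fun i _ _ => hQ b hb i) ?_
    · simp [stateDelta, da, cb]
    · simpa [edgeL, edgeR, da, cb] using restrictedGF_eq_stateSum p a b false false L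
  · refine hasFermionicForm_of_state (e := false) (d := true) (r := p - b) (by omega) (by omega)
      (by omega) (fun i _ => ?_) (fun i _ _ => hR a hap i) (fun i _ _ => hR b hbp i) ?_
    · simp [stateDelta, da, db]
    · simpa [edgeL, edgeR, da, db] using restrictedGF_eq_stateSum p a b false true L
  · refine hasFermionicForm_of_state (e := true) (d := true) (r := p - b) (by omega) (by omega)
      (by omega) (fun i _ => ?_) (fun i _ _ => hQ a ha i) (fun i _ _ => hR b hbp i) ?_
    · simp [stateDelta, ca, db]
    · simpa [edgeL, edgeR, ca, db] using restrictedGF_eq_stateSum p a b true true L
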